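/- Let $\Omega\subset\mathbb R^2$ be a bounded Lipschitz domain and let $\mathcal T_h$ be a (finite) conforming triangular mesh of $\Omega$, that is, a finite set of closed nondegenerate triangles whose union is $\overline\Omega$ and any two of which are disjoint or meet exactly in a common vertex or a common edge. Let $\mathcal F_h$ be its set of edges and $\mathcal F_h^I$ the set of interior edges (those shared by two triangles). Number the vertices of each $K\in\mathcal T_h$ as $\nu_1,\nu_2,\nu_3$, with barycentric coordinates $\lambda_{K,\nu_i}$; for an edge $F$ of $K$ let $\lambda_{K,F}$ be the barycentric coordinate of the vertex of $K$ opposite to $F$. Fix for each $F\in\mathcal F_h$ an order $(a_F,b_F)$ of its endpoints and a unit normal $n_F$, chosen as the outward one on boundary edges. Let $L_j$ be the Legendre polynomial of degree $j$ on $[-1,1]$ with $L_j(1)=1$, and $L_j^F$ its composition with the affine map of $F$ onto $[-1,1]$ sending $a_F$ to $-1$ and $b_F$ to $1$. For $v\in H^1(\mathcal T_h,\Omega)=\{v\in L^2(\Omega): v_{|K}\in H^1(K)\ \forall K\in\mathcal T_h\}$ and $F\in\mathcal F_h^I$ shared by $K_1,K_2$, let $[\![v]\!]=\gamma_{K_1}(v)_{|F}\,(n_{K_1}\cdot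 n_F)+\gamma_{K_2}(v)_{|F}\,(n_{K_2}\cdot n_F)$, where $\gamma_K$ is the trace and $n_K$ the outward unit normal of $K$. Let $p$ be an even positive integer. Define $$\widetilde V_n^{\rm im}=\Big\{v\in H^1(\mathcal T_h,\Omega)\ :\ v_{|K}\in\mathbb P_p(K)\ \ \forall K\in\mathcal T_h,\quad \int_F[\![v]\!]\,L_j^F\,ds=0\ \ \forall F\in\mathcal F_h^I,\ \forall j\in\{0,\dots,p-2,p\}\Big\},$$ and let $\widetilde V_n^{\rm ex}$ be the linear span in $L^2(\Omega)$ of the following functions: * for each $F\in\mathcal F_h$, the edge bubble $b_{p-1}^F$, equal to $L_{p-1}(1-2\lambda_{K,F})$ on each $K\in\mathcal T_h$ having $F$ as an edge, and $0$ on the other triangles; * for each $F\in\mathcal F_h$ and $j=1,\dots,p-1$, the modal edge function $\varphi_j^F$, equal to $\frac{8\sqrt{4j+2}}{j(j+1)}\,\lambda_{K,a_F}\lambda_{K,b_F}\,L_j'(\lambda_{K,b_F}-\lambda_{K,a_F})$ on each $K$ having $F$ as an edge, and $0$ on the other triangles; * for each $K\in\mathcal T_h$ and all integers $r_1,r_2\ge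 0$ with $r_1+r_2\le p-3$, the element bubble $\varphi_{r_1,r_2}^K$, equal to $\lambda_{K,\nu_1}\lambda_{K,\nu_2}\lambda_{K,\nu_3}\,L_{r_1}(\lambda_{K,\nu_2}-\lambda_{K,\nu_1})\,L_{r_2}(2\lambda_{K,\nu_3}-1)$ on $K$, and $0$ on the other triangles. Then $\widetilde V_n^{\rm im}=\widetilde V_n^{\rm ex}$. -/

import Mathlib

open MeasureTheory Filter Topology
open scoped ContDiff RealInnerProductSpace

noncomputable section

namespace CrouzeixRaviart

/-- The Euclidean plane. -/
abbrev Plane : Type := EuclideanSpace ℝ (Fin 2)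

/-! ### Legendre polynomials -/

/-- The Legendre polynomial `L_n` on `[-1, 1]`, normalised by `L_n(1) = 1` (Rodrigues' formula). -/
def legendre (n : ℕ) : Polynomial ℝ :=
  Polynomial.C (1 / (2 ^ n * (n.factorial : ℝ))) *
    Polynomial.derivative^[n] ((Polynomial.X ^ 2 - 1) ^ n)

/-! ### Triangles -/

/-- The open triangle with vertex set `K`. -/
def cell (K : Finset Plane) : Set Plane := interior (convexHull ℝ (K : Set Plane))

open Classical in
/-- The barycentric coordinate `λ_{K,ν}` of the triangle with vertex set `K`: the affine function
that is `1` at the vertex `ν` and `0` at the other vertices (see `bary_apply`). -/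
def bary (K : Finset Plane) (ν : Plane) : Plane →ᵃ[ℝ] ℝ :=
  if h : ∃ l : Plane →ᵃ[ℝ] ℝ, ∀ x ∈ K, l x = if x = ν then 1 else 0 then h.choose else 0

open Classical in
theorem bary_apply {K : Finset Plane} (hK : AffineIndependent ℝ ((↑) : K → Plane))
    (hcard : K.card = 3) (ν : Plane) {x : Plane} (hx : x ∈ K) :
    bary K ν x = if x = ν then 1 else 0 := by
  have h : ∃ l : Plane →ᵃ[ℝ] ℝ, ∀ x ∈ K, l x = if x = ν then 1 else 0 := by
    by_cases hν : ν ∈ K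
    · have htop : affineSpan ℝ (Set.range ((↑) : K → Plane)) = ⊤ := by
        rw [hK.affineSpan_eq_top_iff_card_eq_finrank_add_one]
        simp [hcard]
      let b : AffineBasis K ℝ Plane := ⟨_, hK, htop⟩
      refine ⟨b.coord ⟨ν, hν⟩, fun y hy => ?_⟩
      have := b.coord_apply ⟨ν, hν⟩ ⟨y, hy⟩
      have hb : b ⟨y, hy⟩ = y := rfl
      rw [hb] at this
      rw [this]
      simp [Subtype.ext_iff, eq_comm]
    · refine ⟨0, fun y hy => ?_⟩
      have : y ≠ ν := fun e => hν (e ▸ hy)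
      simp [this]
  unfold bary
  rw [dif_pos h]
  exact h.choose_spec x hx

open Classical in
/-- For an edge `F` of the triangle `K`, the barycentric coordinate `λ_{K,F}` of the vertex
opposite to `F` (the sum has exactly one term). -/
def baryOpp (K F : Finset Plane) (x : Plane) : ℝ := ∑ ν ∈ K \ F, bary K ν x

/-- The unit outward normal `n_K` of the triangle `K` on its edge `F`: since `λ_{K,F}` is affine,
zero on `F` and positive inside `K`, it is `-∇λ_{K,F} / |∇λ_{K,F}|`. -/
def outwardNormal (K F : Finset Plane) : Plane :=
  -(‖gradient (baryOpp K F) 0‖⁻¹ • gradient (baryOpp K F) 0)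

/-! ### Sobolev functions, traces, polynomials -/

/-- `v` belongs to `H¹(U)`: it is square integrable on `U` and has a square integrable weak
gradient `g` there. -/
def MemH1 (U : Set Plane) (v : Plane → ℝ) : Prop :=
  MemLp v 2 (volume.restrict U) ∧
    ∃ g : Plane → Plane, MemLp g 2 (volume.restrict U) ∧
      ∀ φ : Plane → ℝ, ContDiff ℝ ∞ φ → HasCompactSupport φ → tsupport φ ⊆ U →
        ∀ e : Plane, ∫ x in U, v x * fderiv ℝ φ x e = -∫ x in U, ⟪g x, e⟫ * φ x

/-- The trace `γ_K(v)` at a point `x` of the boundary of the triangle `K`. For `v ∈ H¹(K)` the mean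
values of `v` over `K ∩ B(x, r)` converge, as `r → 0`, to the value of the trace at almost every
boundary point `x`; for `v` continuous up to the boundary the trace is the restriction of `v`. -/
def trace (K : Finset Plane) (v : Plane → ℝ) (x : Plane) : ℝ :=
  limUnder (𝓝[>] (0 : ℝ)) fun r => ⨍ y in cell K ∩ Metric.ball x r, v y

/-- `v` coincides almost everywhere on the triangle `K` with a polynomial in two variables of total
degree at most `p`, that is, `v|_K ∈ ℙ_p(K)`. -/
def IsPolyOn (p : ℕ) (K : Finset Plane) (v : Plane → ℝ) : Prop :=
  ∃ q : MvPolynomial (Fin 2) ℝ, q.totalDegree ≤ p ∧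
    ∀ᵐ x ∂(volume.restrict (cell K)), v x = MvPolynomial.eval (fun i => x i) q

/-! ### Integrals over edges -/

/-- The `L²` product `(f, g)_{0,F}` on the edge `F` with endpoints `a` and `b`, with respect to arc
length. -/
def edgeInner (a b : Plane) (f g : Plane → ℝ) : ℝ :=
  dist a b * ∫ t in (0 : ℝ)..1, f (AffineMap.lineMap a b t) * g (AffineMap.lineMap a b t)

/-- The mapped Legendre polynomial `L_j^F` on the edge `F` with endpoints `a` and `b`: the
composition of `L_j` with the affine map of `F` onto `[-1, 1]` that sends `a` to `-1` and `b`
to `1`. -/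
def edgeLegendre (a b : Plane) (j : ℕ) (x : Plane) : ℝ :=
  (legendre j).eval (2 * (⟪x - a, b - a⟫ / ‖b - a‖ ^ 2) - 1)

/-! ### Meshes -/

/-- A conforming simplicial mesh of `Ω ⊆ ℝ²`: a finite geometric simplicial complex all of whose
simplices are faces of triangles of the complex, and whose triangles cover the closure of `Ω`.
(That two simplices meet along a common face, or not at all, is part of `SimplicialComplex`.) -/
structure Mesh (Ω : Set Plane) extends Geometry.SimplicialComplex ℝ Plane where
  finite : faces.Finite
  pure : ∀ s ∈ faces, ∃ K ∈ faces, K.card = 3 ∧ s ⊆ K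
  space_eq : toSimplicialComplex.space = closure Ω

namespace Mesh

variable {Ω : Set Plane} (T : Mesh Ω)

/-- The elements of the mesh, each given by its set of three vertices. -/
def elements : Finset (Finset Plane) := T.finite.toFinset.filter fun K => K.card = 3

/-- The edges of the mesh, each given by its set of two endpoints. -/
def edges : Finset (Finset Plane) := T.finite.toFinset.filter fun F => F.card = 2

open Classical in
/-- The elements of which `F` is an edge; their union is the edge patch `ω_F`. -/
def patch (F : Finset Plane) : Finset (Finset Plane) := T.elements.filter fun K => F ⊆ K

/-- Interior edges: those shared by two different elements. -/
def IsInteriorEdge (F : Finset Plane) : Prop :=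
  F ∈ T.edges ∧ ∃ K₁ ∈ T.patch F, ∃ K₂ ∈ T.patch F, K₁ ≠ K₂

/-- Boundary edges: those that belong to one element only. -/
def IsBoundaryEdge (F : Finset Plane) : Prop :=
  F ∈ T.edges ∧ ¬ T.IsInteriorEdge F

/-- The choices that are fixed once and for all on a mesh: the numbering of the two endpoints of
each edge (the direction in which the edge is parametrised), the numbering of the three vertices of
each element, and a unit normal of each edge, pointing out of the element on boundary edges. -/
structure Choices where
  endpoint : Finset Plane → Fin 2 → Plane
  endpoint_range : ∀ F ∈ T.edges, Set.range (endpoint F) = F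
  vertex : Finset Plane → Fin 3 → Plane
  vertex_range : ∀ K ∈ T.elements, Set.range (vertex K) = K
  normal : Finset Plane → Plane
  normal_norm : ∀ F ∈ T.edges, ‖normal F‖ = 1
  normal_orthogonal : ∀ F ∈ T.edges, ∀ a ∈ F, ∀ b ∈ F, ⟪normal F, b - a⟫ = 0
  normal_boundary : ∀ F, T.IsBoundaryEdge F → ∀ K ∈ T.patch F, normal F = outwardNormal K F

/-- The function that is given by `f K` on each (open) element `K` of the mesh. -/
def glue (f : Finset Plane → Plane → ℝ) (x : Plane) : ℝ :=
  ∑ K ∈ T.elements, (cell K).indicator (f K) x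

theorem memLp_glue {f : Finset Plane → Plane → ℝ} (hf : ∀ K, Continuous (f K)) :
    MemLp (T.glue f) 2 (volume.restrict Ω) := by
  have key : ∀ K ∈ T.elements, MemLp ((cell K).indicator (f K)) 2 (volume.restrict Ω) := by
    intro K _
    have hc : IsCompact (convexHull ℝ (K : Set Plane)) :=
      K.finite_toSet.isCompact_convexHull ℝ
    have hm : MeasurableSet (cell K) := isOpen_interior.measurableSet
    obtain ⟨C, hC⟩ := hc.exists_bound_of_continuousOn (hf K).continuousOn
    refine MemLp.mono_measure Measure.restrict_le_self ?_
    rw [memLp_indicator_iff_restrict hm]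
    have hfin : volume (cell K) < ⊤ := (measure_mono interior_subset).trans_lt hc.measure_lt_top
    have : IsFiniteMeasure (volume.restrict (cell K)) := ⟨by simpa using hfin⟩
    refine MemLp.of_bound (hf K).aestronglyMeasurable C ?_
    exact (ae_restrict_iff' hm).2 (Eventually.of_forall fun x hx => hC x (interior_subset hx))
  have := memLp_finsetSum T.elements key
  exact this

/-- The element of `L²(Ω)` that is given by `f K` on each element `K` of the mesh. -/
def glueLp (f : Finset Plane → Plane → ℝ) (hf : ∀ K, Continuous (f K)) :
    Lp ℝ 2 (volume.restrict Ω) :=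
  (T.memLp_glue hf).toLp (T.glue f)

/-! ### The implicit space -/

/-- The broken Sobolev space `H¹(𝒯_h, Ω)`. -/
def brokenH1 : Set (Lp ℝ 2 (volume.restrict Ω)) :=
  {v | ∀ K ∈ T.elements, MemH1 (cell K) v}

variable {T} in
/-- The jump of `v` on the edge `F`: the sum of `γ_K(v) (n_K · n_F)` over the elements `K` with
edge `F`. There are two of them if `F` is an interior edge; on a boundary edge the jump is `γ_K(v)`,
because there `n_F = n_K`. -/
def Choices.jump (c : T.Choices) (F : Finset Plane) (v : Plane → ℝ) (x : Plane) : ℝ :=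
  ∑ K ∈ T.patch F, trace K v x * ⟪outwardNormal K F, c.normal F⟫

variable {T} in
/-- The modified nonconforming Sobolev space: the functions in `H¹(𝒯_h, Ω)` whose jumps on the
interior edges `F` are orthogonal to `L_j^F` for `j = 0, …, p - 2, p`. -/
def Choices.modifiedNonconformingH1 (c : T.Choices) (p : ℕ) :
    Set (Lp ℝ 2 (volume.restrict Ω)) :=
  {v | v ∈ T.brokenH1 ∧ ∀ F, T.IsInteriorEdge F → ∀ j : ℕ, j ≤ p → j + 1 ≠ p →
    edgeInner (c.endpoint F 0) (c.endpoint F 1) (c.jump F v)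
      (edgeLegendre (c.endpoint F 0) (c.endpoint F 1) j) = 0}

variable {T} in
/-- The implicit Crouzeix–Raviart space of even degree `p`. -/
def Choices.implicitSpace (c : T.Choices) (p : ℕ) : Set (Lp ℝ 2 (volume.restrict Ω)) :=
  {v | v ∈ c.modifiedNonconformingH1 p ∧ ∀ K ∈ T.elements, IsPolyOn p K v}

end Mesh

/-! ### The explicit space -/

theorem continuous_bary (K : Finset Plane) (ν : Plane) : Continuous (bary K ν) :=
  AffineMap.continuous_of_finiteDimensional _

open Classical in
/-- The restriction to the element `K` of the nonconforming bubble `b_m^F`. -/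
def edgeBubbleOn (m : ℕ) (F K : Finset Plane) (x : Plane) : ℝ :=
  if F ⊆ K then (legendre m).eval (1 - 2 * baryOpp K F x) else 0

open Classical in
/-- The restriction to the element `K` of the modal edge function `φ_j^F`, where `F` is the edge
with endpoints `a` and `b`. -/
def modalEdgeOn (j : ℕ) (a b : Plane) (K : Finset Plane) (x : Plane) : ℝ :=
  if a ∈ K ∧ b ∈ K then
    8 * √(4 * j + 2) / (j * (j + 1)) * bary K a x * bary K b x *
      (Polynomial.derivative (legendre j)).eval (-bary K a x + bary K b x)
  else 0

open Classical in
/-- The restriction to the element `K'` of the modal element bubble `φ_{r₁,r₂}^K`, where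
`ν 0, ν 1, ν 2` are the vertices of `K`. -/
def modalElementOn (r₁ r₂ : ℕ) (K : Finset Plane) (ν : Fin 3 → Plane) (K' : Finset Plane)
    (x : Plane) : ℝ :=
  if K' = K then
    bary K (ν 0) x * bary K (ν 1) x * bary K (ν 2) x *
      (legendre r₁).eval (bary K (ν 1) x - bary K (ν 0) x) *
      (legendre r₂).eval (2 * bary K (ν 2) x - 1)
  else 0

theorem continuous_edgeBubbleOn (m : ℕ) (F K : Finset Plane) :
    Continuous (edgeBubbleOn m F K) := by
  have h := continuous_bary K
  unfold edgeBubbleOn baryOpp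
  split_ifs <;> fun_prop

theorem continuous_modalEdgeOn (j : ℕ) (a b : Plane) (K : Finset Plane) :
    Continuous (modalEdgeOn j a b K) := by
  have h := continuous_bary K
  unfold modalEdgeOn
  split_ifs <;> fun_prop

theorem continuous_modalElementOn (r₁ r₂ : ℕ) (K : Finset Plane) (ν : Fin 3 → Plane)
    (K' : Finset Plane) : Continuous (modalElementOn r₁ r₂ K ν K') := by
  have h := continuous_bary K
  unfold modalElementOn
  split_ifs <;> fun_prop

namespace Mesh

variable {Ω : Set Plane} {T : Mesh Ω}

/-- The nonconforming edge bubble `b_m^F`, as an element of `L²(Ω)`. -/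
def edgeBubble (T : Mesh Ω) (m : ℕ) (F : Finset Plane) : Lp ℝ 2 (volume.restrict Ω) :=
  T.glueLp (edgeBubbleOn m F) (continuous_edgeBubbleOn m F)

/-- The modal edge function `φ_j^F`, as an element of `L²(Ω)`. -/
def Choices.modalEdge (c : T.Choices) (j : ℕ) (F : Finset Plane) :
    Lp ℝ 2 (volume.restrict Ω) :=
  T.glueLp (modalEdgeOn j (c.endpoint F 0) (c.endpoint F 1))
    (continuous_modalEdgeOn j (c.endpoint F 0) (c.endpoint F 1))

/-- The modal element bubble `φ_{r₁,r₂}^K`, as an element of `L²(Ω)`. -/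
def Choices.modalElement (c : T.Choices) (r₁ r₂ : ℕ) (K : Finset Plane) :
    Lp ℝ 2 (volume.restrict Ω) :=
  T.glueLp (modalElementOn r₁ r₂ K (c.vertex K))
    (continuous_modalElementOn r₁ r₂ K (c.vertex K))

/-- The explicit Crouzeix–Raviart space of even degree `p`: the span of the bubbles `b_{p-1}^F`, the
modal edge functions `φ_j^F`, `1 ≤ j ≤ p - 1`, and the modal element bubbles `φ_{r₁,r₂}^K`,
`r₁ + r₂ ≤ p - 3`. -/
def Choices.explicitSpace (c : T.Choices) (p : ℕ) : Submodule ℝ (Lp ℝ 2 (volume.restrict Ω)) :=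
  Submodule.span ℝ
    ({v | ∃ F ∈ T.edges, v = T.edgeBubble (p - 1) F} ∪
      {v | ∃ F ∈ T.edges, ∃ j : ℕ, 1 ≤ j ∧ j + 1 ≤ p ∧ v = c.modalEdge j F} ∪
      {v | ∃ K ∈ T.elements, ∃ r₁ r₂ : ℕ, r₁ + r₂ + 3 ≤ p ∧ v = c.modalElement r₁ r₂ K})

end Mesh

end CrouzeixRaviart

end

noncomputable section

namespace CrouzeixRaviart

/-! ### Legendre polynomials -/

section Legendre

open Polynomial

/-! An element of either space is determined by one polynomial on each triangle, because the open
cells cover `Ω` up to a null set. So `L²` classes are traded for families `f K` of polynomial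
functions (`Represents`). The trace of such a family is the restriction of `f K` and the two outward
normals on an interior edge are opposite, so the jump is a nonzero multiple of the difference of two
polynomials of degree at most `p`. Orthogonality to every `L_j` with `j ≤ p` except `j = p - 1`
means exactly that this difference is a multiple of `L_{p-1}`. This describes the implicit space by
`jumpSpace` (`mem_implicitSpace_iff`).

The explicit functions lie in `jumpSpace`: an edge bubble is `1` on its own edge and `0` or
`±L_{p-1}` on any other edge of an element, while the modal functions agree from both sides
(`explicitFun_le_jumpSpace`).

Conversely, a family `f` in `jumpSpace` is stripped in three stages (`exists_explicitFun_eq`).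
Vertices: `p - 1` is odd, so `L_{p-1}` takes opposite values at the ends of an edge, and the sum
`2α_F` of the endpoint values of `f K` on `F` does not depend on `K`. The bubble of `F` is `1` at
the ends of `F` and `-1` at the opposite vertex, so `∑ α_F b_F` has the same vertex values as `f`.
Edges: once the vertex values vanish, so does the coefficient of `L_{p-1}` in each jump. The edge
values are then single-valued, of the form `(1 - s²) r(s)` with `deg r ≤ p - 2`, and the derivatives
`L_1', …, L_{p-1}'` span all such `r`. Interiors: what is left vanishes on all edges, hence is
`λ₁λ₂λ₃` times a polynomial of degree at most `p - 3` (zero if `p = 2`), and products of Legendre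
polynomials in two affine coordinates span those. -/

theorem degree_legendre (n : ℕ) : (legendre n).degree = n := by
  have hmonic : ((X ^ 2 - 1 : ℝ[X]) ^ n).Monic := (monic_X_pow_sub_C (1 : ℝ) two_ne_zero).pow n
  have hdeg : ((X ^ 2 - 1 : ℝ[X]) ^ n).natDegree = n + n := by
    have h := natDegree_X_pow_sub_C (n := 2) (r := (1 : ℝ))
    rw [C_1] at h
    rw [natDegree_pow, h]
    ring
  have hc : (1 / (2 ^ n * (n.factorial : ℝ))) ≠ 0 := by positivity
  rw [legendre, degree_C_mul hc]
  apply le_antisymm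
  · refine degree_le_of_natDegree_le ((natDegree_iterate_derivative _ _).trans ?_)
    omega
  · apply le_degree_of_ne_zero
    rw [coeff_iterate_derivative, ← hdeg, hmonic.coeff_natDegree, nsmul_eq_mul, mul_one, hdeg]
    exact_mod_cast (Nat.descFactorial_pos.2 (by omega)).ne'

theorem natDegree_legendre (n : ℕ) : (legendre n).natDegree = n :=
  natDegree_eq_of_degree_eq_some (degree_legendre n)

/-- In Leibniz' rule for `(X - 1)^n (X + 1)^n`, only the term with all `n` derivatives on `(X -
1)^n` survives at `1`; it equals `n! 2^n`. -/
theorem eval_one_legendre (n : ℕ) : (legendre n).eval 1 = 1 := by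
  have hfac : (X ^ 2 - 1 : ℝ[X]) ^ n = (X - C 1) ^ n * (X + C 1) ^ n := by
    rw [← mul_pow, C_1]; ring
  rw [legendre, hfac, iterate_derivative_mul, eval_mul, eval_finsetSum, Finset.sum_eq_single 0]
  · rw [Nat.sub_zero, iterate_derivative_X_sub_pow_self]
    have : (n.factorial : ℝ) ≠ 0 := by positivity
    simp
    norm_num
    field_simp
  · intro k hk hk0
    have hk' : k < n + 1 := Finset.mem_range.1 hk
    have : n - (n - k) ≠ 0 := by omega
    rw [iterate_derivative_X_sub_pow]
    simp [this]
  · simp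

theorem iterate_derivative_comp_neg_X (q : ℝ[X]) (k : ℕ) :
    derivative^[k] (q.comp (-X)) = (-1) ^ k * (derivative^[k] q).comp (-X) := by
  induction k generalizing q with
  | zero => simp
  | succ k ih =>
    rw [Function.iterate_succ_apply, derivative_comp, derivative_neg, derivative_X,
      Function.iterate_succ_apply, neg_one_mul, iterate_derivative_neg, ih, pow_succ]
    ring

theorem eval_neg_legendre (n : ℕ) (x : ℝ) :
    (legendre n).eval (-x) = (-1) ^ n * (legendre n).eval x := by
  have h := iterate_derivative_comp_neg_X ((X ^ 2 - 1) ^ n) n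
  have hcomp : ((X ^ 2 - 1 : ℝ[X]) ^ n).comp (-X) = (X ^ 2 - 1) ^ n := by simp
  rw [hcomp] at h
  have h' := congrArg (eval (-x)) h
  simp only [eval_mul, eval_pow, eval_neg, eval_one, eval_comp, eval_X, neg_neg] at h'
  simp only [legendre, eval_mul, eval_C, h']
  ring

theorem eval_neg_one_legendre (n : ℕ) : (legendre n).eval (-1) = (-1) ^ n := by
  rw [eval_neg_legendre, eval_one_legendre, mul_one]

theorem intervalIntegrable_eval (q : ℝ[X]) (a b : ℝ) :
    IntervalIntegrable (fun x => q.eval x) volume a b :=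
  q.continuous.intervalIntegrable a b

/-- Integration by parts moves the derivatives onto `q` one at a time. The boundary terms vanish
because a derivative of order below `n` keeps a factor `X² - 1`. Allowing any `k ≤ n` is what makes
the induction run. -/
theorem integral_iterate_derivative_mul_eq_zero {n k : ℕ} (hk : k ≤ n) (q : ℝ[X])
    (hq : q.natDegree < k) :
    ∫ x in (-1 : ℝ)..1, (derivative^[k] ((X ^ 2 - 1 : ℝ[X]) ^ n)).eval x * q.eval x = 0 := by
  induction k generalizing q with
  | zero => omega
  | succ k ih =>
    set w := derivative^[k] ((X ^ 2 - 1 : ℝ[X]) ^ n) with hw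
    have hdvd : (X ^ 2 - 1 : ℝ[X]) ∣ w :=
      (dvd_pow_self _ (by omega)).trans (pow_sub_dvd_iterate_derivative_pow _ n k)
    have hroot : ∀ x : ℝ, x ^ 2 = 1 → w.eval x = 0 := by
      intro x hx
      obtain ⟨u, hu⟩ := hdvd
      rw [hu]
      simp [hx]
    have hparts := intervalIntegral.integral_mul_deriv_eq_deriv_mul (a := (-1 : ℝ)) (b := 1)
      (u := fun x => q.eval x) (v := fun x => w.eval x)
      (fun x _ => q.hasDerivAt x) (fun x _ => w.hasDerivAt x)
      (intervalIntegrable_eval _ _ _) (intervalIntegrable_eval _ _ _)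
    rw [Function.iterate_succ_apply', ← hw]
    simp_rw [mul_comm (eval _ (derivative w))]
    rw [hparts, hroot 1 (by norm_num), hroot (-1) (by norm_num)]
    simp only [mul_zero, sub_zero, zero_sub, neg_eq_zero]
    -- Differentiation does not lower `natDegree` when it is already `0`, so constants are handled
    -- apart.
    rcases Nat.eq_zero_or_pos q.natDegree with h0 | h0
    · simp [derivative_of_natDegree_zero h0]
    · simp_rw [mul_comm (eval _ (derivative q))]
      exact ih (by omega) _ ((natDegree_derivative_lt h0.ne').trans_le (by omega))

theorem integral_legendre_mul_eq_zero {n : ℕ} (q : ℝ[X]) (hq : q.natDegree < n) :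
    ∫ x in (-1 : ℝ)..1, (legendre n).eval x * q.eval x = 0 := by
  have h := integral_iterate_derivative_mul_eq_zero le_rfl q hq
  simp only [legendre, eval_mul, eval_C, mul_assoc]
  rw [intervalIntegral.integral_const_mul, h, mul_zero]

theorem integral_legendre_mul_legendre_eq_zero {m n : ℕ} (h : m ≠ n) :
    ∫ x in (-1 : ℝ)..1, (legendre m).eval x * (legendre n).eval x = 0 := by
  rcases h.lt_or_gt with h | h
  · simp_rw [mul_comm ((legendre m).eval _)]
    exact integral_legendre_mul_eq_zero _ (by rwa [natDegree_legendre])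
  · exact integral_legendre_mul_eq_zero _ (by rwa [natDegree_legendre])

/-- One polynomial in each degree is a triangular basis. It is applied to the Legendre polynomials
and to the shifted derivatives `L_{n+1}'`. -/
theorem mem_span_of_degree_eq {P : ℕ → ℝ[X]} (hP : ∀ n, (P n).degree = n) {m : ℕ} {q : ℝ[X]}
    (hq : q.natDegree ≤ m) : q ∈ Submodule.span ℝ (P '' Set.Iic m) := by
  let S : Polynomial.Sequence ℝ := ⟨P, hP⟩
  have h := S.span_degreeLE (m := m) fun i _ =>
    (leadingCoeff_ne_zero.2 (S.ne_zero i)).isUnit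
  change q ∈ Submodule.span ℝ (S '' Set.Iic m)
  rw [h, mem_degreeLE]
  exact degree_le_of_natDegree_le hq

theorem degree_derivative_legendre (n : ℕ) : (derivative (legendre (n + 1))).degree = n := by
  rw [degree_derivative (by rw [natDegree_legendre]; omega), natDegree_legendre]
  simp

theorem eq_zero_of_integral_mul_self {q : ℝ[X]}
    (h : ∫ x in (-1 : ℝ)..1, q.eval x * q.eval x = 0) : q = 0 := by
  by_contra hq
  have hfin : (q.roots.toFinset : Set ℝ).Finite := Finset.finite_toSet _
  obtain ⟨x, hx, hxq⟩ :=
    (Set.Icc_infinite (show (-1 : ℝ) < 1 by norm_num)).exists_notMem_finite hfin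
  have hpos : 0 < ∫ x in (-1 : ℝ)..1, q.eval x * q.eval x := by
    apply intervalIntegral.integral_pos (by norm_num)
      (q.continuous.mul q.continuous).continuousOn
      (fun x _ => mul_self_nonneg _)
    refine ⟨x, hx, mul_self_pos.2 ?_⟩
    simpa [hq] using hxq
  exact hpos.ne' h

/-- Remove the `L_m` component from `q`. The remainder is orthogonal to all `L_j`, `j ≤ p`, hence to
their span, which contains the remainder itself. -/
theorem eq_C_mul_legendre_of_orthogonal {m p : ℕ} (hm : m ≤ p) {q : ℝ[X]} (hq : q.natDegree ≤ p)
    (horth : ∀ j ≤ p, j ≠ m → ∫ x in (-1 : ℝ)..1, q.eval x * (legendre j).eval x = 0) :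
    ∃ c : ℝ, q = C c * legendre m := by
  have hLm : (∫ x in (-1 : ℝ)..1, (legendre m).eval x * (legendre m).eval x) ≠ 0 := by
    intro h
    have := degree_legendre m
    rw [eq_zero_of_integral_mul_self h] at this
    simp at this
  set c := (∫ x in (-1 : ℝ)..1, q.eval x * (legendre m).eval x) /
    ∫ x in (-1 : ℝ)..1, (legendre m).eval x * (legendre m).eval x with hc
  have hmulint : ∀ u v : ℝ[X], IntervalIntegrable (fun x => u.eval x * v.eval x) volume (-1) 1 :=
    fun u v => (u.continuous.mul v.continuous).intervalIntegrable _ _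
  set r := q - C c * legendre m with hr
  have hrdeg : r.natDegree ≤ p := by
    refine (natDegree_sub_le _ _).trans (max_le hq ?_)
    refine (natDegree_C_mul_le _ _).trans ?_
    rwa [natDegree_legendre]
  have hrL : ∀ j ≤ p, ∫ x in (-1 : ℝ)..1, r.eval x * (legendre j).eval x = 0 := by
    intro j hj
    simp only [hr, eval_sub, eval_mul, eval_C, sub_mul, mul_assoc]
    rw [intervalIntegral.integral_sub (hmulint _ _) ((hmulint _ _).const_mul _),
      intervalIntegral.integral_const_mul]
    by_cases hjm : j = m
    · subst hjm
      rw [hc, div_mul_cancel₀ _ hLm, sub_self]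
    · rw [horth j hj hjm, integral_legendre_mul_legendre_eq_zero (Ne.symm hjm)]
      simp
  have hrall : ∀ u ∈ Submodule.span ℝ (legendre '' Set.Iic p),
      ∫ x in (-1 : ℝ)..1, r.eval x * u.eval x = 0 := by
    intro u hu
    induction hu using Submodule.span_induction with
    | mem u hu =>
      obtain ⟨j, hj, rfl⟩ := hu
      exact hrL j hj
    | zero => simp
    | add u v _ _ hu hv =>
      simp only [eval_add, mul_add]
      rw [intervalIntegral.integral_add (hmulint _ _) (hmulint _ _), hu, hv, add_zero]
    | smul a u _ hu =>
      simp only [eval_smul, smul_eq_mul, mul_left_comm _ a]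
      rw [intervalIntegral.integral_const_mul, hu, mul_zero]
  have hr0 : r = 0 := eq_zero_of_integral_mul_self
    (hrall r (mem_span_of_degree_eq degree_legendre hrdeg))
  exact ⟨c, sub_eq_zero.1 hr0⟩

theorem exists_eq_mul_of_eval_eq_zero {q : ℝ[X]} {p : ℕ} (hp : 2 ≤ p) (hq : q.natDegree ≤ p)
    (h1 : q.eval 1 = 0) (h2 : q.eval (-1) = 0) :
    ∃ r : ℝ[X], r.natDegree ≤ p - 2 ∧ q = (1 - X ^ 2) * r := by
  obtain ⟨u, hu⟩ := dvd_iff_isRoot.2 (show q.IsRoot 1 from h1)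
  have hu' : u.eval (-1) = 0 := by
    rw [hu, eval_mul] at h2
    norm_num at h2
    exact h2
  obtain ⟨w, hw⟩ := dvd_iff_isRoot.2 (show u.IsRoot (-1) from hu')
  refine ⟨-w, ?_, ?_⟩
  · rw [natDegree_neg]
    by_cases hw0 : w = 0
    · simp [hw0]
    have hdeg : q.natDegree = 1 + (1 + w.natDegree) := by
      rw [hu, hw, natDegree_mul (X_sub_C_ne_zero _) (mul_ne_zero (X_sub_C_ne_zero _) hw0),
        natDegree_mul (X_sub_C_ne_zero _) hw0, natDegree_X_sub_C, natDegree_X_sub_C]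
    omega
  · rw [hu, hw]
    simp only [map_one, map_neg]
    ring

end Legendre

/-! ### Polynomial functions on the plane -/

section PolyFun

open Polynomial

/-- The space of affine functions on the plane. -/
def affFun : Submodule ℝ (Plane → ℝ) :=
  LinearMap.range
    ({ toFun := fun l => (l : Plane → ℝ)
       map_add' := fun _ _ => rfl
       map_smul' := fun _ _ => rfl } : (Plane →ᵃ[ℝ] ℝ) →ₗ[ℝ] (Plane → ℝ))

theorem coe_mem_affFun (l : Plane →ᵃ[ℝ] ℝ) : (l : Plane → ℝ) ∈ affFun := ⟨l, rfl⟩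

theorem one_le_affFun : (1 : Submodule ℝ (Plane → ℝ)) ≤ affFun := by
  rw [Submodule.one_le]
  exact ⟨AffineMap.const ℝ Plane 1, rfl⟩

/-- The space of polynomial functions of degree at most `n` on the plane. -/
def polyFun (n : ℕ) : Submodule ℝ (Plane → ℝ) := affFun ^ n

theorem polyFun_mono {m n : ℕ} (h : m ≤ n) : polyFun m ≤ polyFun n :=
  pow_le_pow_right₀ one_le_affFun h

theorem mul_mem_polyFun {m n : ℕ} {f g : Plane → ℝ} (hf : f ∈ polyFun m) (hg : g ∈ polyFun n) :
    f * g ∈ polyFun (m + n) := by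
  rw [polyFun, pow_add]
  exact Submodule.mul_mem_mul hf hg

theorem coe_mem_polyFun (l : Plane →ᵃ[ℝ] ℝ) : (l : Plane → ℝ) ∈ polyFun 1 := by
  rw [polyFun, pow_one]
  exact coe_mem_affFun l

theorem const_mem_polyFun (c : ℝ) (n : ℕ) : (fun _ => c : Plane → ℝ) ∈ polyFun n := by
  refine polyFun_mono (Nat.zero_le n) ?_
  rw [polyFun, pow_zero, Submodule.mem_one]
  exact ⟨c, rfl⟩

/-- Induction on the degree of a polynomial function. -/
theorem polyFun_induction {C : ℕ → (Plane → ℝ) → Prop}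
    (const : ∀ c : ℝ, C 0 (fun _ => c))
    (add : ∀ n f g, C n f → C n g → C n (f + g))
    (mul : ∀ (l : Plane →ᵃ[ℝ] ℝ) n f, f ∈ polyFun n → C n f → C (n + 1) (l * f))
    {n : ℕ} {f : Plane → ℝ} (hf : f ∈ polyFun n) : C n f := by
  refine Submodule.pow_induction_on_left' affFun (C := fun n f _ => C n f) const
    (fun f g n _ _ => add n f g) ?_ hf
  rintro _ ⟨l, rfl⟩ n f hf h
  exact mul l n f hf h

theorem contDiff_of_mem_polyFun {n : ℕ} {f : Plane → ℝ} (hf : f ∈ polyFun n) :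
    ContDiff ℝ ∞ f := by
  refine polyFun_induction (C := fun _ f => ContDiff ℝ ∞ f) (fun c => contDiff_const)
    (fun _ f g hf hg => hf.add hg) (fun l n f _ hf => ?_) hf
  exact (ContinuousAffineMap.contDiff ⟨l, l.continuous_of_finiteDimensional⟩).mul hf

theorem continuous_of_mem_polyFun {n : ℕ} {f : Plane → ℝ} (hf : f ∈ polyFun n) : Continuous f :=
  (contDiff_of_mem_polyFun hf).continuous

theorem coord_mem_polyFun (i : Fin 2) : (fun x : Plane => x i) ∈ polyFun 1 :=
  coe_mem_polyFun (EuclideanSpace.proj i : Plane →L[ℝ] ℝ).toLinearMap.toAffineMap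

theorem pow_mem_polyFun {m : ℕ} {f : Plane → ℝ} (hf : f ∈ polyFun m) (k : ℕ) :
    f ^ k ∈ polyFun (m * k) := by
  rw [polyFun, pow_mul]
  exact Submodule.pow_mem_pow _ hf k

theorem eval_mem_polyFun {n : ℕ} {q : MvPolynomial (Fin 2) ℝ} (hq : q.totalDegree ≤ n) :
    (fun x : Plane => MvPolynomial.eval (fun i => x i) q) ∈ polyFun n := by
  have heq : (fun x : Plane => MvPolynomial.eval (fun i => x i) q) =
      ∑ d ∈ q.support,
        q.coeff d • ((fun x : Plane => x 0) ^ d 0 * (fun x : Plane => x 1) ^ d 1) := by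
    funext x
    rw [MvPolynomial.eval_eq']
    simp [Finset.sum_apply, Fin.prod_univ_two]
  rw [heq]
  refine Submodule.sum_mem _ fun d hd => Submodule.smul_mem _ _ ?_
  have h := mul_mem_polyFun (pow_mem_polyFun (coord_mem_polyFun 0) (d 0))
    (pow_mem_polyFun (coord_mem_polyFun 1) (d 1))
  refine polyFun_mono ?_ h
  have hdeg := (MvPolynomial.le_totalDegree hd).trans hq
  rw [Finsupp.sum_fintype _ _ (by simp), Fin.sum_univ_two] at hdeg
  omega

theorem affine_apply_eq (l : Plane →ᵃ[ℝ] ℝ) :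
    ∀ x : Plane, l x = l 0 + l.linear (EuclideanSpace.single 0 1) * x 0 +
      l.linear (EuclideanSpace.single 1 1) * x 1 := by
  intro x
  have hx : x = x 0 • EuclideanSpace.single 0 (1 : ℝ) + x 1 • EuclideanSpace.single 1 (1 : ℝ) := by
    ext i
    fin_cases i <;> simp
  have h := l.map_vadd 0 x
  simp only [vadd_eq_add, add_zero] at h
  rw [h]
  conv_lhs => rw [hx]
  simp only [map_add, map_smul, smul_eq_mul]
  ring

theorem exists_eval_eq_of_mem_polyFun {n : ℕ} {f : Plane → ℝ} (hf : f ∈ polyFun n) :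
    ∃ q : MvPolynomial (Fin 2) ℝ, q.totalDegree ≤ n ∧
      ∀ x : Plane, f x = MvPolynomial.eval (fun i => x i) q := by
  refine polyFun_induction (C := fun n f => ∃ q : MvPolynomial (Fin 2) ℝ, q.totalDegree ≤ n ∧
      ∀ x : Plane, f x = MvPolynomial.eval (fun i => x i) q) ?_ ?_ ?_ hf
  · exact fun c => ⟨MvPolynomial.C c, by simp, by simp⟩
  · rintro n f g ⟨q, hq, hfq⟩ ⟨r, hr, hgr⟩
    exact ⟨q + r, (MvPolynomial.totalDegree_add _ _).trans (max_le hq hr), by simp [hfq, hgr]⟩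
  · rintro l n f - ⟨q, hq, hfq⟩
    let e : MvPolynomial (Fin 2) ℝ := MvPolynomial.C (l 0) +
      MvPolynomial.C (l.linear (EuclideanSpace.single 0 1)) * MvPolynomial.X 0 +
      MvPolynomial.C (l.linear (EuclideanSpace.single 1 1)) * MvPolynomial.X 1
    have he : e.totalDegree ≤ 1 := by
      have hmon : ∀ (c : ℝ) (i : Fin 2),
          (MvPolynomial.C c * MvPolynomial.X i : MvPolynomial (Fin 2) ℝ).totalDegree ≤ 1 := by
        intro c i
        refine (MvPolynomial.totalDegree_mul _ _).trans ?_
        simp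
      refine (MvPolynomial.totalDegree_add _ _).trans (max_le ?_ (hmon _ _))
      refine (MvPolynomial.totalDegree_add _ _).trans (max_le ?_ (hmon _ _))
      simp
    refine ⟨e * q, (MvPolynomial.totalDegree_mul _ _).trans (by omega), fun x => ?_⟩
    rw [Pi.mul_apply, hfq, affine_apply_eq l x]
    simp [e]

theorem isPolyOn_iff {p : ℕ} {K : Finset Plane} {v : Plane → ℝ} :
    IsPolyOn p K v ↔ ∃ f ∈ polyFun p, v =ᵐ[volume.restrict (cell K)] f := by
  constructor
  · rintro ⟨q, hq, hv⟩
    exact ⟨_, eval_mem_polyFun hq, hv⟩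
  · rintro ⟨f, hf, hv⟩
    obtain ⟨q, hq, hfq⟩ := exists_eval_eq_of_mem_polyFun hf
    refine ⟨q, hq, hv.mono fun x hx => ?_⟩
    rw [hx, hfq]

theorem eval_comp_mem_polyFun (l : Plane →ᵃ[ℝ] ℝ) {n : ℕ} {q : ℝ[X]} (hq : q.natDegree ≤ n) :
    (fun x => q.eval (l x)) ∈ polyFun n := by
  have heq : (fun x => q.eval (l x)) =
      ∑ i ∈ Finset.range (q.natDegree + 1), q.coeff i • ((l : Plane → ℝ) ^ i) := by
    funext x
    rw [eval_eq_sum_range]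
    simp [Finset.sum_apply]
  rw [heq]
  refine Submodule.sum_mem _ fun i hi => Submodule.smul_mem _ _ ?_
  have := Finset.mem_range.1 hi
  exact polyFun_mono (by omega) (pow_mem_polyFun (coe_mem_polyFun l) i)

theorem exists_eval_eq_on_line (a b : Plane) {n : ℕ} {f : Plane → ℝ} (hf : f ∈ polyFun n) :
    ∃ q : ℝ[X], q.natDegree ≤ n ∧
      ∀ s : ℝ, f (AffineMap.lineMap a b ((s + 1) / 2)) = q.eval s := by
  refine polyFun_induction (C := fun n f => ∃ q : ℝ[X], q.natDegree ≤ n ∧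
      ∀ s : ℝ, f (AffineMap.lineMap a b ((s + 1) / 2)) = q.eval s) ?_ ?_ ?_ hf
  · exact fun c => ⟨C c, by simp, by simp⟩
  · rintro n f g ⟨q, hq, hfq⟩ ⟨r, hr, hgr⟩
    exact ⟨q + r, (natDegree_add_le _ _).trans (max_le hq hr), by simp [hfq, hgr]⟩
  · rintro l n f - ⟨q, hq, hfq⟩
    refine ⟨(C ((l b - l a) / 2) * X + C ((l a + l b) / 2)) * q,
      natDegree_mul_le.trans ?_, fun s => ?_⟩
    · have := natDegree_linear_le (a := (l b - l a) / 2) (b := (l a + l b) / 2)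
      omega
    · rw [Pi.mul_apply, hfq, AffineMap.apply_lineMap, AffineMap.lineMap_apply_ring']
      simp only [eval_mul, eval_add, eval_C, eval_X]
      ring

/-- Two affine functions which, together with the constants, span all affine functions. -/
def AffineCoords (s t : Plane → ℝ) : Prop :=
  ∀ l : Plane →ᵃ[ℝ] ℝ, ∃ c₀ c₁ c₂ : ℝ, ∀ x, l x = c₀ + c₁ * s x + c₂ * t x

/-- Division by the affine function `s`, with a remainder depending on `t` alone. The quotient has
degree `n - 1`; the two clauses replace truncated subtraction, so that for `n = 0` the quotient is
zero rather than a constant. -/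
theorem exists_eq_mul_add_eval {s t : Plane →ᵃ[ℝ] ℝ} (hst : AffineCoords s t) {n : ℕ}
    {f : Plane → ℝ} (hf : f ∈ polyFun n) :
    ∃ (g : Plane → ℝ) (q : ℝ[X]), (∀ m, n = m + 1 → g ∈ polyFun m) ∧ (n = 0 → g = 0) ∧
      q.natDegree ≤ n ∧ ∀ x, f x = s x * g x + q.eval (t x) := by
  refine polyFun_induction (C := fun n f => ∃ (g : Plane → ℝ) (q : ℝ[X]),
      (∀ m, n = m + 1 → g ∈ polyFun m) ∧ (n = 0 → g = 0) ∧
      q.natDegree ≤ n ∧ ∀ x, f x = s x * g x + q.eval (t x)) ?_ ?_ ?_ hf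
  · exact fun c => ⟨0, C c, by simp, by simp, by simp, by simp⟩
  · rintro n f g ⟨u, q, hu, hu0, hq, hfq⟩ ⟨v, r, hv, hv0, hr, hgr⟩
    refine ⟨u + v, q + r, fun m hm => Submodule.add_mem _ (hu m hm) (hv m hm), fun h => ?_,
      (natDegree_add_le _ _).trans (max_le hq hr), fun x => ?_⟩
    · rw [hu0 h, hv0 h, add_zero]
    · simp only [Pi.add_apply, hfq, hgr, eval_add]
      ring
  · rintro l n f - ⟨g, q, hg, hg0, hq, hfq⟩
    obtain ⟨c₀, c₁, c₂, hl⟩ := hst l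
    -- Expand `l (s g + q(t))` with `l = c₀ + c₁ s + c₂ t`: the term `c₁ s q(t)` joins the quotient,
    -- the rest of `l q(t)` is the new remainder.
    refine ⟨l * g + c₁ • (fun x => q.eval (t x)), (C c₂ * X + C c₀) * q, ?_, by omega,
      natDegree_mul_le.trans ?_, fun x => ?_⟩
    · intro m hm
      obtain rfl : n = m := by omega
      refine Submodule.add_mem _ ?_ (Submodule.smul_mem _ _ (eval_comp_mem_polyFun t hq))
      rcases n with - | n
      · rw [hg0 rfl, mul_zero]
        exact Submodule.zero_mem _
      · have := mul_mem_polyFun (coe_mem_polyFun l) (hg n rfl)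
        rwa [add_comm] at this
    · have := natDegree_linear_le (a := c₂) (b := c₀)
      omega
    · simp only [Pi.mul_apply, Pi.add_apply, Pi.smul_apply, hfq, smul_eq_mul, eval_mul, eval_add,
        eval_C, eval_X, hl x]
      ring

/-- A polynomial function vanishing on a piece of the line `s = 0` is divisible by `s`. -/
theorem exists_eq_mul_of_eq_zero {s t : Plane →ᵃ[ℝ] ℝ} (hst : AffineCoords s t) {n : ℕ}
    {f : Plane → ℝ} (hf : f ∈ polyFun n)
    (h0 : ∀ τ ∈ Set.Ioo (0 : ℝ) 1, ∃ x, s x = 0 ∧ t x = τ ∧ f x = 0) :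
    ∃ g : Plane → ℝ, (∀ m, n = m + 1 → g ∈ polyFun m) ∧ (n = 0 → g = 0) ∧
      ∀ x, f x = s x * g x := by
  obtain ⟨g, q, hg, hg0, -, hfq⟩ := exists_eq_mul_add_eval hst hf
  -- On the line `s = 0` only the remainder is left, and it has infinitely many roots. The open
  -- interval suffices, which later permits cancelling factors that vanish only at vertices.
  have hq : q = 0 := by
    refine eq_zero_of_infinite_isRoot q
      ((Set.Ioo_infinite (show (0 : ℝ) < 1 by norm_num)).mono fun τ hτ => ?_)
    obtain ⟨x, hs, ht, hfx⟩ := h0 τ hτ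
    have := hfq x
    rw [hfx, hs, ht, zero_mul, zero_add] at this
    exact this.symm
  exact ⟨g, hg, hg0, fun x => by simp [hfq x, hq]⟩

theorem mem_span_monomials {s t : Plane →ᵃ[ℝ] ℝ} (hst : AffineCoords s t) {n : ℕ}
    {f : Plane → ℝ} (hf : f ∈ polyFun n) :
    f ∈ Submodule.span ℝ {g : Plane → ℝ | ∃ i j : ℕ, i + j ≤ n ∧ g = fun x => s x ^ i * t x ^ j} := by
  refine polyFun_induction (C := fun n f => f ∈ Submodule.span ℝ
    {g : Plane → ℝ | ∃ i j : ℕ, i + j ≤ n ∧ g = fun x => s x ^ i * t x ^ j}) ?_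
    (fun _ _ _ => Submodule.add_mem _) ?_ hf
  · intro c
    have : (fun _ => c : Plane → ℝ) = c • fun x => s x ^ 0 * t x ^ 0 := by
      funext x; simp
    rw [this]
    exact Submodule.smul_mem _ _ (Submodule.subset_span ⟨0, 0, le_rfl, rfl⟩)
  · intro l n f hfn hf
    clear hfn
    obtain ⟨c₀, c₁, c₂, hl⟩ := hst l
    induction hf using Submodule.span_induction with
    | mem g hg =>
      obtain ⟨i, j, hij, rfl⟩ := hg
      have : (l : Plane → ℝ) * (fun x => s x ^ i * t x ^ j) =
          c₀ • (fun x => s x ^ i * t x ^ j) + c₁ • (fun x => s x ^ (i + 1) * t x ^ j) +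
            c₂ • (fun x => s x ^ i * t x ^ (j + 1)) := by
        funext x
        simp only [Pi.mul_apply, Pi.add_apply, Pi.smul_apply, smul_eq_mul, hl x]
        ring
      rw [this]
      refine Submodule.add_mem _ (Submodule.add_mem _ ?_ ?_) ?_ <;>
        refine Submodule.smul_mem _ _ (Submodule.subset_span ⟨_, _, ?_, rfl⟩) <;> omega
    | zero => rw [mul_zero]; exact Submodule.zero_mem _
    | add f g _ _ hf hg => rw [mul_add]; exact Submodule.add_mem _ hf hg
    | smul a f _ hf => rw [mul_smul_comm]; exact Submodule.smul_mem _ _ hf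

/-- Each power `X^k` is a combination of `L_0, …, L_k`, so by bilinearity a monomial `s^i t^j`
expands into products whose total degree does not exceed `i + j`. -/
theorem mem_span_legendre {s t : Plane →ᵃ[ℝ] ℝ} (hst : AffineCoords s t) {n : ℕ}
    {f : Plane → ℝ} (hf : f ∈ polyFun n) :
    f ∈ Submodule.span ℝ {g : Plane → ℝ | ∃ i j : ℕ, i + j ≤ n ∧
      g = fun x => (legendre i).eval (s x) * (legendre j).eval (t x)} := by
  refine Submodule.span_le.2 ?_ (mem_span_monomials hst hf)
  rintro _ ⟨i, j, hij, rfl⟩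
  let B : ℝ[X] →ₗ[ℝ] ℝ[X] →ₗ[ℝ] (Plane → ℝ) :=
    LinearMap.mk₂ ℝ (fun u v x => u.eval (s x) * v.eval (t x))
      (fun u u' v => by funext x; simp [add_mul])
      (fun a u v => by funext x; simp [mul_assoc])
      (fun u v v' => by funext x; simp [mul_add])
      (fun a u v => by funext x; simp [mul_left_comm])
  have hX : ∀ k : ℕ, (X ^ k : ℝ[X]) ∈ Submodule.span ℝ (legendre '' Set.Iic k) := fun k =>
    mem_span_of_degree_eq degree_legendre (natDegree_X_pow_le k)
  have h := Submodule.apply_mem_map₂ B (hX i) (hX j)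
  rw [Submodule.map₂_span_span] at h
  have hB : (fun x => s x ^ i * t x ^ j) = B (X ^ i) (X ^ j) := by
    funext x; simp [B]
  rw [SetLike.mem_coe, hB]
  refine Submodule.span_mono ?_ h
  rintro _ ⟨_, ⟨i', hi', rfl⟩, _, ⟨j', hj', rfl⟩, rfl⟩
  exact ⟨i', j', (add_le_add hi' hj').trans hij, rfl⟩

end PolyFun

/-! ### Triangles -/

/-- `K` is the vertex set of a nondegenerate triangle with the vertices `a`, `b`, `c`. -/
structure IsTri (K : Finset Plane) (a b c : Plane) : Prop where
  indep : AffineIndependent ℝ ((↑) : K → Plane)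
  ne_ab : a ≠ b
  ne_ac : a ≠ c
  ne_bc : b ≠ c
  mem_iff : ∀ x, x ∈ K ↔ x = a ∨ x = b ∨ x = c

namespace IsTri

variable {K : Finset Plane} {a b c : Plane}

theorem rotate (h : IsTri K a b c) : IsTri K b c a :=
  ⟨h.indep, h.ne_bc, h.ne_ab.symm, h.ne_ac.symm, fun x => by rw [h.mem_iff]; tauto⟩

theorem swap (h : IsTri K a b c) : IsTri K b a c :=
  ⟨h.indep, h.ne_ab.symm, h.ne_bc, h.ne_ac, fun x => by rw [h.mem_iff]; tauto⟩

theorem mem_a (h : IsTri K a b c) : a ∈ K := by simp [h.mem_iff]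

theorem mem_b (h : IsTri K a b c) : b ∈ K := by simp [h.mem_iff]

theorem mem_c (h : IsTri K a b c) : c ∈ K := by simp [h.mem_iff]

open Classical in
theorem eq_insert (h : IsTri K a b c) : K = {a, b, c} := by
  ext x
  simp [h.mem_iff]

theorem card_eq (h : IsTri K a b c) : K.card = 3 := by
  classical
  rw [h.eq_insert]
  exact Finset.card_eq_three.2 ⟨a, b, c, h.ne_ab, h.ne_ac, h.ne_bc, rfl⟩

theorem bary_self (h : IsTri K a b c) : bary K a a = 1 := by
  rw [bary_apply h.indep h.card_eq a h.mem_a, if_pos rfl]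

theorem bary_of_ne (h : IsTri K a b c) {x y : Plane} (hy : y ∈ K) (hxy : y ≠ x) :
    bary K x y = 0 := by
  rw [bary_apply h.indep h.card_eq x hy, if_neg hxy]

/-- Identifies `bary` with the coordinates of an affine basis, which gives access to the general
facts about barycentric coordinates. -/
theorem exists_affineBasis (h : IsTri K a b c) : ∃ β : AffineBasis K ℝ Plane,
    (∀ i, β i = (i : Plane)) ∧ ∀ i x, β.coord i x = bary K i x := by
  have htop : affineSpan ℝ (Set.range ((↑) : K → Plane)) = ⊤ := by
    rw [h.indep.affineSpan_eq_top_iff_card_eq_finrank_add_one]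
    simp [h.card_eq]
  let β : AffineBasis K ℝ Plane := ⟨_, h.indep, htop⟩
  refine ⟨β, fun _ => rfl, fun i x => ?_⟩
  suffices heq : β.coord i = bary K i from congrArg (fun l => l x) heq
  refine AffineMap.ext_on htop ?_
  rintro _ ⟨y, rfl⟩
  rw [bary_apply h.indep h.card_eq i y.2]
  have := β.coord_apply i y
  change β.coord i (β y) = _
  rw [this]
  refine if_congr ?_ rfl rfl
  rw [Subtype.ext_iff]
  exact eq_comm

theorem sum_coe (h : IsTri K a b c) {M : Type*} [AddCommMonoid M] (g : Plane → M) :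
    ∑ i : K, g i = g a + g b + g c := by
  classical
  rw [Finset.sum_coe_sort K g, h.eq_insert, Finset.sum_insert, Finset.sum_pair h.ne_bc, add_assoc]
  simp [h.ne_ab, h.ne_ac]

theorem sum_bary (h : IsTri K a b c) (x : Plane) : bary K a x + bary K b x + bary K c x = 1 := by
  obtain ⟨β, hβ, hc⟩ := h.exists_affineBasis
  have := β.sum_coord_apply_eq_one x
  simp_rw [hc] at this
  rwa [h.sum_coe fun ν => bary K ν x] at this

theorem eq_combination (h : IsTri K a b c) (x : Plane) :
    x = bary K a x • a + bary K b x • b + bary K c x • c := by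
  obtain ⟨β, hβ, hc⟩ := h.exists_affineBasis
  have := β.linear_combination_coord_eq_self x
  simp_rw [hc, hβ] at this
  rw [h.sum_coe fun ν => bary K ν x • ν] at this
  exact this.symm

/-- An affine function is determined by its values at the vertices. -/
theorem apply_eq (h : IsTri K a b c) (l : Plane →ᵃ[ℝ] ℝ) (x : Plane) :
    l x = l a * bary K a x + l b * bary K b x + l c * bary K c x := by
  have hdec : ∀ y, l y = l.linear y + l 0 := fun y => by
    simpa using congrFun l.decomp y
  rw [hdec x]
  conv_lhs => enter [1]; rw [h.eq_combination x]
  rw [hdec a, hdec b, hdec c]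
  simp only [map_add, map_smul, smul_eq_mul]
  linear_combination (-l 0) * h.sum_bary x

theorem affineCoords (h : IsTri K a b c) : AffineCoords (bary K a) (bary K b) := by
  intro l
  refine ⟨l c, l a - l c, l b - l c, fun x => ?_⟩
  rw [h.apply_eq l x]
  linear_combination (l c) * h.sum_bary x

/-- These are the arguments of the two Legendre factors in the element bubbles. The coefficients
come from `λ_c = (1 + t)/2` and `λ_a, λ_b = (1 - t)/4 ∓ s/2`. -/
theorem affineCoords_legendre (h : IsTri K a b c) :
    AffineCoords (bary K b - bary K a : Plane →ᵃ[ℝ] ℝ)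
      ((2 : ℝ) • bary K c - AffineMap.const ℝ Plane (1 : ℝ) : Plane →ᵃ[ℝ] ℝ) := by
  intro l
  refine ⟨(l a + l b + 2 * l c) / 4, (l b - l a) / 2, (2 * l c - l a - l b) / 4, fun x => ?_⟩
  rw [h.apply_eq l x]
  simp
  linear_combination ((l a + l b) / 2) * h.sum_bary x

theorem range_eq_coe (β : AffineBasis K ℝ Plane) (hβ : ∀ i, β i = (i : Plane)) :
    Set.range β = (K : Set Plane) := by
  ext x
  simp [hβ]

theorem mem_cell_iff (h : IsTri K a b c) {x : Plane} :
    x ∈ cell K ↔ 0 < bary K a x ∧ 0 < bary K b x ∧ 0 < bary K c x := by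
  obtain ⟨β, hβ, hc⟩ := h.exists_affineBasis
  rw [cell, ← range_eq_coe β hβ, β.interior_convexHull]
  simp [hc, h.mem_iff]

theorem cell_nonempty (h : IsTri K a b c) : (cell K).Nonempty := by
  obtain ⟨β, hβ, hc⟩ := h.exists_affineBasis
  rw [cell, ← range_eq_coe β hβ]
  exact ⟨_, β.centroid_mem_interior_convexHull⟩

/-- A convex set with nonempty interior lies in the closure of that interior. It makes edge points
admissible for `trace_eq`. -/
theorem convexHull_subset_closure_cell (h : IsTri K a b c) :
    convexHull ℝ (K : Set Plane) ⊆ closure (cell K) := by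
  rw [cell, (convex_convexHull ℝ _).closure_interior_eq_closure_of_nonempty_interior
    h.cell_nonempty]
  exact subset_closure

theorem lineMap_mem_convexHull (h : IsTri K a b c) {t : ℝ} (ht : t ∈ Set.Icc (0 : ℝ) 1) :
    AffineMap.lineMap a b t ∈ convexHull ℝ (K : Set Plane) :=
  (convex_convexHull ℝ _).lineMap_mem (subset_convexHull ℝ _ h.mem_a)
    (subset_convexHull ℝ _ h.mem_b) ht

theorem bary_lineMap_a (h : IsTri K a b c) (t : ℝ) :
    bary K a (AffineMap.lineMap a b t) = 1 - t := by
  rw [AffineMap.apply_lineMap, AffineMap.lineMap_apply_ring', h.bary_self,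
    h.bary_of_ne h.mem_b h.ne_ab.symm]
  ring

theorem bary_lineMap_b (h : IsTri K a b c) (t : ℝ) :
    bary K b (AffineMap.lineMap a b t) = t := by
  rw [AffineMap.apply_lineMap, AffineMap.lineMap_apply_ring', h.swap.bary_self,
    h.bary_of_ne h.mem_a h.ne_ab]
  ring

theorem bary_lineMap_c (h : IsTri K a b c) (t : ℝ) :
    bary K c (AffineMap.lineMap a b t) = 0 := by
  rw [AffineMap.apply_lineMap, AffineMap.lineMap_apply_ring', h.bary_of_ne h.mem_b h.ne_bc,
    h.bary_of_ne h.mem_a h.ne_ac]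
  ring

theorem baryOpp_eq (h : IsTri K a b c) {F : Finset Plane} (hF : ∀ x, x ∈ F ↔ x = a ∨ x = b) :
    baryOpp K F = bary K c := by
  classical
  have hKF : K \ F = {c} := by
    ext x
    have := h.ne_ac
    have := h.ne_bc
    simp only [Finset.mem_sdiff, h.mem_iff, hF, Finset.mem_singleton]
    grind
  funext x
  unfold baryOpp
  convert Finset.sum_singleton (fun ν => bary K ν x) c using 2

/-- Two triangles with disjoint interiors and a common edge lie on different sides of it. -/
theorem exists_neg_bary_eq {K₁ K₂ : Finset Plane} {c₁ c₂ : Plane} (h₁ : IsTri K₁ a b c₁)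
    (h₂ : IsTri K₂ a b c₂) (hdisj : Disjoint (cell K₁) (cell K₂)) :
    ∃ κ : ℝ, κ < 0 ∧ ∀ x, bary K₂ c₂ x = κ * bary K₁ c₁ x := by
  -- Both coordinates vanish at `a` and `b`, so they are proportional.
  have heq : ∀ x, bary K₂ c₂ x = bary K₂ c₂ c₁ * bary K₁ c₁ x := by
    intro x
    rw [h₁.apply_eq (bary K₂ c₂) x, h₂.bary_of_ne h₂.mem_a h₂.ne_ac,
      h₂.bary_of_ne h₂.mem_b h₂.ne_bc]
    ring
  refine ⟨_, ?_, heq⟩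
  by_contra! hκ
  have hκ0 : bary K₂ c₂ c₁ ≠ 0 := by
    intro h0
    have := heq c₂
    rw [h₂.rotate.rotate.bary_self, h0, zero_mul] at this
    exact one_ne_zero this
  have hκpos : 0 < bary K₂ c₂ c₁ := lt_of_le_of_ne hκ hκ0.symm
  set A := bary K₂ a c₁
  set B := bary K₂ b c₁
  -- If the factor were positive, moving from the midpoint of the edge slightly towards `c₁` would
  -- stay in both cells. This `ε` is small enough that the coordinates `A`, `B` of `c₁` in `K₂`
  -- cannot outweigh the midpoint's values `1/2`.
  set ε : ℝ := 1 / (2 + 2 * |A| + 2 * |B|) with hε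
  have hden : 0 < 2 + 2 * |A| + 2 * |B| := by positivity
  have hε0 : 0 < ε := by positivity
  have hε1 : ε * (2 + 2 * |A| + 2 * |B|) = 1 := by rw [hε]; field_simp
  set x := AffineMap.lineMap (AffineMap.lineMap a b (1 / 2 : ℝ)) c₁ ε with hx
  have hl : ∀ l : Plane →ᵃ[ℝ] ℝ, l x = (1 - ε) * l (AffineMap.lineMap a b (1 / 2 : ℝ)) + ε * l c₁ := by
    intro l
    rw [hx, AffineMap.apply_lineMap, AffineMap.lineMap_apply_ring]
  have hεA : ε * |A| ≥ 0 := by positivity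
  have hεB : ε * |B| ≥ 0 := by positivity
  have hA : -(ε * |A|) ≤ ε * A := by
    have := neg_abs_le A
    nlinarith
  have hB : -(ε * |B|) ≤ ε * B := by
    have := neg_abs_le B
    nlinarith
  have hx₁ : x ∈ cell K₁ := by
    rw [h₁.mem_cell_iff]
    simp only [hl, h₁.bary_lineMap_a, h₁.bary_lineMap_b, h₁.bary_lineMap_c,
      h₁.rotate.rotate.bary_self, h₁.bary_of_ne h₁.mem_c h₁.ne_ac.symm,
      h₁.bary_of_ne h₁.mem_c h₁.ne_bc.symm]
    refine ⟨?_, ?_, ?_⟩ <;> nlinarith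
  have hx₂ : x ∈ cell K₂ := by
    rw [h₂.mem_cell_iff]
    simp only [hl, h₂.bary_lineMap_a, h₂.bary_lineMap_b, h₂.bary_lineMap_c]
    refine ⟨?_, ?_, ?_⟩
    · change 0 < (1 - ε) * (1 - 1 / 2) + ε * A
      nlinarith
    · change 0 < (1 - ε) * (1 / 2) + ε * B
      nlinarith
    · have := mul_pos hε0 hκpos
      linarith
  exact Set.disjoint_left.1 hdisj hx₁ hx₂

theorem fderiv_affine (l : Plane →ᵃ[ℝ] ℝ) (x y : Plane) : fderiv ℝ l x y = l.linear y := by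
  have h : HasFDerivAt l (LinearMap.toContinuousLinearMap l.linear) x := by
    have := (LinearMap.toContinuousLinearMap l.linear).hasFDerivAt (x := x)
    have h2 := this.add_const (l 0)
    refine h2.congr_of_eventuallyEq (Eventually.of_forall fun z => ?_)
    simpa using congrFun l.decomp z
  rw [h.fderiv]
  rfl

/-- If the product vanished, `λ_c` would be constant along `n`, so `n` would be parallel to the
edge; being also orthogonal to it, `n` would be zero. Nonvanishing is all that is needed of the sign
factor in the jump. -/
theorem inner_outwardNormal_ne_zero (h : IsTri K a b c) {F : Finset Plane}
    (hF : ∀ x, x ∈ F ↔ x = a ∨ x = b) {n : Plane} (hn : ‖n‖ = 1) (hort : ⟪n, b - a⟫ = 0) :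
    ⟪outwardNormal K F, n⟫ ≠ 0 := by
  have hlin : ∀ (l : Plane →ᵃ[ℝ] ℝ) (y : Plane), l.linear y = l y - l 0 := fun l y => by
    have := congrFun l.decomp y
    simp at this
    rw [this]; ring
  have hgrad : gradient (bary K c) 0 ≠ 0 := by
    intro h0
    have h1 := inner_gradient_left (𝕜 := ℝ) (f := bary K c) (x := 0) (y := c - a)
    rw [h0, inner_zero_left, fderiv_affine, map_sub, hlin, hlin, h.rotate.rotate.bary_self,
      h.bary_of_ne h.mem_a h.ne_ac] at h1
    norm_num at h1
  rw [outwardNormal, h.baryOpp_eq hF, inner_neg_left, real_inner_smul_left]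
  refine neg_ne_zero.2 (mul_ne_zero (inv_ne_zero (norm_ne_zero_iff.2 hgrad)) ?_)
  rw [inner_gradient_left, fderiv_affine]
  intro h0
  have hn' : n = (bary K b).linear n • (b - a) := by
    have e1 := h.eq_combination n
    have e2 := h.eq_combination 0
    have s1 := h.sum_bary n
    have s2 := h.sum_bary 0
    rw [hlin] at h0 ⊢
    have hc : bary K c n = bary K c 0 := by linarith
    have ha : bary K a n - bary K a 0 = -(bary K b n - bary K b 0) := by linarith
    calc n = n - 0 := by simp
      _ = (bary K a n - bary K a 0) • a + (bary K b n - bary K b 0) • b := by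
        conv_lhs => rw [e2]
        conv_lhs => enter [1]; rw [e1]
        rw [hc]
        module
      _ = _ := by rw [ha]; module
  have hnn : ⟪n, n⟫ = 0 := by
    conv_lhs => enter [3]; rw [hn']
    rw [real_inner_smul_right, hort, mul_zero]
  rw [inner_self_eq_zero] at hnn
  simp [hnn] at hn

/-- The two gradients differ by a negative factor, which normalisation turns into `-1`. -/
theorem outwardNormal_eq_neg {K₁ K₂ : Finset Plane} {c₁ c₂ : Plane} (h₁ : IsTri K₁ a b c₁)
    (h₂ : IsTri K₂ a b c₂) (hdisj : Disjoint (cell K₁) (cell K₂)) {F : Finset Plane}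
    (hF : ∀ x, x ∈ F ↔ x = a ∨ x = b) : outwardNormal K₂ F = -outwardNormal K₁ F := by
  obtain ⟨κ, hκ, heq⟩ := h₁.exists_neg_bary_eq h₂ hdisj
  have hgrad : gradient (bary K₂ c₂) 0 = κ • gradient (bary K₁ c₁) 0 := by
    have hfun : (bary K₂ c₂ : Plane → ℝ) = ⇑(κ • bary K₁ c₁) := funext heq
    refine ext_inner_right ℝ fun y => ?_
    rw [real_inner_smul_left, inner_gradient_left, inner_gradient_left, hfun, fderiv_affine,
      fderiv_affine]
    rfl
  rw [outwardNormal, outwardNormal, h₁.baryOpp_eq hF, h₂.baryOpp_eq hF, hgrad, norm_smul,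
    Real.norm_eq_abs, abs_of_neg hκ, mul_inv, smul_smul, neg_neg, ← neg_smul]
  congr 1
  have hκ0 : κ ≠ 0 := hκ.ne
  rw [inv_neg, neg_mul, neg_mul, neg_neg, mul_right_comm, inv_mul_cancel₀ hκ0, one_mul]

end IsTri

theorem exists_isTri {K : Finset Plane} (hK : AffineIndependent ℝ ((↑) : K → Plane))
    (hcard : K.card = 3) {a b : Plane} (ha : a ∈ K) (hb : b ∈ K) (hab : a ≠ b) :
    ∃ c, IsTri K a b c := by
  classical
  have h1 : ((K.erase a).erase b).card = 1 := by
    rw [Finset.card_erase_of_mem (Finset.mem_erase.2 ⟨hab.symm, hb⟩),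
      Finset.card_erase_of_mem ha, hcard]
  obtain ⟨c, hc⟩ := Finset.card_eq_one.1 h1
  have hmem : ∀ x, (x ≠ b ∧ x ≠ a ∧ x ∈ K) ↔ x = c := fun x => by
    rw [← Finset.mem_singleton, ← hc]
    simp
  have hc' := (hmem c).2 rfl
  refine ⟨c, hK, hab, hc'.2.1.symm, hc'.1.symm, fun x => ⟨fun hx => ?_, ?_⟩⟩
  · by_cases hxa : x = a
    · exact Or.inl hxa
    by_cases hxb : x = b
    · exact Or.inr (Or.inl hxb)
    exact Or.inr (Or.inr ((hmem x).1 ⟨hxb, hxa, hx⟩))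
  · rintro (rfl | rfl | rfl)
    exacts [ha, hb, hc'.2.2]

/-! ### Traces and Sobolev regularity of polynomials -/

theorem isOpen_cell (K : Finset Plane) : IsOpen (cell K) := isOpen_interior

theorem measurableSet_cell (K : Finset Plane) : MeasurableSet (cell K) :=
  (isOpen_cell K).measurableSet

theorem isCompact_hull (K : Finset Plane) : IsCompact (convexHull ℝ (K : Set Plane)) :=
  K.finite_toSet.isCompact_convexHull ℝ

theorem volume_cell_lt_top (K : Finset Plane) : volume (cell K) < ⊤ :=
  (measure_mono interior_subset).trans_lt (isCompact_hull K).measure_lt_top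

theorem integrableOn_cell {f : Plane → ℝ} (hf : Continuous f) (K : Finset Plane) :
    IntegrableOn f (cell K) :=
  (hf.continuousOn.integrableOn_compact (isCompact_hull K)).mono_set interior_subset

theorem memLp_cell {E : Type*} [NormedAddCommGroup E] [SecondCountableTopologyEither Plane E]
    {f : Plane → E} (hf : Continuous f)
    (K : Finset Plane) : MemLp f 2 (volume.restrict (cell K)) := by
  obtain ⟨C, hC⟩ := (isCompact_hull K).exists_bound_of_continuousOn hf.continuousOn
  have : IsFiniteMeasure (volume.restrict (cell K)) := ⟨by simpa using volume_cell_lt_top K⟩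
  refine MemLp.of_bound hf.aestronglyMeasurable C ?_
  exact (ae_restrict_iff' (measurableSet_cell K)).2
    (Eventually.of_forall fun x hx => hC x (interior_subset hx))

/-- The averages do not see null sets, so `v` may be replaced by `f`. Near `x` the values of `f` lie
in a small closed ball about `f x`, which is convex and so contains their mean. -/
theorem trace_eq {K : Finset Plane} {v f : Plane → ℝ} (hf : Continuous f)
    (hv : v =ᵐ[volume.restrict (cell K)] f) {x : Plane} (hx : x ∈ closure (cell K)) :
    trace K v x = f x := by
  refine Tendsto.limUnder_eq ?_
  rw [Metric.tendsto_nhds]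
  intro ε hε
  obtain ⟨δ, hδ, hfδ⟩ := Metric.continuousAt_iff.1 hf.continuousAt (ε / 2) (half_pos hε)
  filter_upwards [Ioo_mem_nhdsGT hδ] with r hr
  have hsub : cell K ∩ Metric.ball x r ⊆ cell K := Set.inter_subset_left
  have hmeas : MeasurableSet (cell K ∩ Metric.ball x r) :=
    (measurableSet_cell K).inter Metric.isOpen_ball.measurableSet
  have havg : (⨍ y in cell K ∩ Metric.ball x r, v y) = ⨍ y in cell K ∩ Metric.ball x r, f y :=
    average_congr (ae_restrict_of_ae_restrict_of_subset hsub hv)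
  have hne : volume (cell K ∩ Metric.ball x r) ≠ 0 := by
    refine (((isOpen_cell K).inter Metric.isOpen_ball).measure_pos volume ?_).ne'
    rw [Set.inter_comm]
    exact mem_closure_iff.1 hx _ Metric.isOpen_ball (Metric.mem_ball_self hr.1)
  have hmem := (convex_closedBall (f x) (ε / 2)).set_average_mem Metric.isClosed_closedBall hne
    ((measure_mono hsub).trans_lt (volume_cell_lt_top K)).ne
    ((ae_restrict_iff' hmeas).2 (Eventually.of_forall fun y hy => Metric.mem_closedBall.2
      (hfδ ((Metric.mem_ball.1 hy.2).trans hr.2)).le))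
    ((integrableOn_cell hf K).mono_set hsub)
  rw [havg]
  exact (Metric.mem_closedBall.1 hmem).trans_lt (half_lt_self hε)

/-- The classical gradient is a weak one: the test function vanishes off the cell, so the
integration by parts can be done on the whole plane. -/
theorem memH1_of_contDiff {K : Finset Plane} {v f : Plane → ℝ} (hf : ContDiff ℝ ∞ f)
    (hv : v =ᵐ[volume.restrict (cell K)] f) : MemH1 (cell K) v := by
  have hdf : Continuous (fderiv ℝ f) := hf.continuous_fderiv (by simp)
  have hg : Continuous (gradient f) :=
    (InnerProductSpace.toDual ℝ Plane).symm.continuous.comp hdf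
  refine ⟨(memLp_congr_ae hv).2 (memLp_cell hf.continuous K), gradient f, memLp_cell hg K, ?_⟩
  intro φ hφ hφc hφK e
  have hdφ : Continuous (fun x => fderiv ℝ φ x e) :=
    (hφ.continuous_fderiv (by simp)).clm_apply continuous_const
  have hdfe : Continuous (fun x => fderiv ℝ f x e) := hdf.clm_apply continuous_const
  have hdφc : HasCompactSupport (fun x => fderiv ℝ φ x e) := hφc.fderiv_apply ℝ e
  have hzero : ∀ x, x ∉ cell K → φ x = 0 := fun x hx =>
    image_eq_zero_of_notMem_tsupport fun h => hx (hφK h)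
  have hdzero : ∀ x, x ∉ cell K → fderiv ℝ φ x e = 0 := fun x hx => by
    rw [image_eq_zero_of_notMem_tsupport (f := fderiv ℝ φ)
      fun h => hx (hφK (tsupport_fderiv_subset ℝ h))]
    rfl
  have hparts := integral_mul_fderiv_eq_neg_fderiv_mul_of_integrable (μ := volume) (f := f)
    (g := φ) (v := e)
    ((hdfe.mul hφ.continuous).integrable_of_hasCompactSupport hφc.mul_left)
    ((hf.continuous.mul hdφ).integrable_of_hasCompactSupport hdφc.mul_left)
    ((hf.continuous.mul hφ.continuous).integrable_of_hasCompactSupport hφc.mul_left)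
    (fun x _ => hf.differentiable (by simp) x) (fun x _ => hφ.differentiable (by simp) x)
  calc ∫ x in cell K, v x * fderiv ℝ φ x e = ∫ x in cell K, f x * fderiv ℝ φ x e :=
        integral_congr_ae (hv.mono fun x hx => by simp only [hx])
    _ = ∫ x, f x * fderiv ℝ φ x e :=
        setIntegral_eq_integral_of_forall_compl_eq_zero fun x hx => by rw [hdzero x hx, mul_zero]
    _ = -∫ x, fderiv ℝ f x e * φ x := hparts
    _ = -∫ x in cell K, ⟪gradient f x, e⟫ * φ x := by
        simp only [inner_gradient_left]
        rw [setIntegral_eq_integral_of_forall_compl_eq_zero fun x hx => by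
          rw [hzero x hx, mul_zero]]

/-! ### Meshes -/

namespace Mesh

variable {Ω : Set Plane} (T : Mesh Ω)

theorem mem_elements {K : Finset Plane} : K ∈ T.elements ↔ K ∈ T.faces ∧ K.card = 3 := by
  simp [elements]

theorem mem_edges {F : Finset Plane} : F ∈ T.edges ↔ F ∈ T.faces ∧ F.card = 2 := by
  simp [edges]

theorem mem_patch {F K : Finset Plane} : K ∈ T.patch F ↔ K ∈ T.elements ∧ F ⊆ K := by
  simp [patch]

variable {T}

theorem exists_isTri_of_mem {K : Finset Plane} (hK : K ∈ T.elements) {a b : Plane} (ha : a ∈ K)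
    (hb : b ∈ K) (hab : a ≠ b) : ∃ c, IsTri K a b c :=
  exists_isTri (T.indep (T.mem_elements.1 hK).1) (T.mem_elements.1 hK).2 ha hb hab

theorem exists_isTri_of_mem_elements {K : Finset Plane} (hK : K ∈ T.elements) :
    ∃ a b c, IsTri K a b c := by
  obtain ⟨a, ha, b, hb, hab⟩ := Finset.one_lt_card.1 (by
    rw [(T.mem_elements.1 hK).2]; norm_num : 1 < K.card)
  exact ⟨a, b, exists_isTri_of_mem hK ha hb hab⟩

theorem Choices.isTri (c : T.Choices) {K : Finset Plane} (hK : K ∈ T.elements) :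
    IsTri K (c.vertex K 0) (c.vertex K 1) (c.vertex K 2) := by
  classical
  have hr := c.vertex_range K hK
  have himg : Finset.univ.image (c.vertex K) = K := by
    apply Finset.coe_injective
    simp [hr]
  have hinj : Function.Injective (c.vertex K) := by
    rw [← Set.injOn_univ, ← Finset.coe_univ, ← Finset.card_image_iff, himg,
      (T.mem_elements.1 hK).2, Finset.card_univ, Fintype.card_fin]
  refine ⟨T.indep (T.mem_elements.1 hK).1, hinj.ne (by decide), hinj.ne (by decide),
    hinj.ne (by decide), fun x => ?_⟩
  rw [← Finset.mem_coe, ← hr]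
  simp [Fin.exists_fin_succ, eq_comm]

theorem Choices.mem_edge_iff (c : T.Choices) {F : Finset Plane} (hF : F ∈ T.edges) (x : Plane) :
    x ∈ F ↔ x = c.endpoint F 0 ∨ x = c.endpoint F 1 := by
  rw [← Finset.mem_coe, ← c.endpoint_range F hF]
  simp [Fin.exists_fin_succ, eq_comm]

theorem Choices.endpoint_ne (c : T.Choices) {F : Finset Plane} (hF : F ∈ T.edges) :
    c.endpoint F 0 ≠ c.endpoint F 1 := by
  intro h
  have h1 : F.card ≤ 1 := Finset.card_le_one.2 fun x hx y hy => by
    rw [c.mem_edge_iff hF, ← h, or_self] at hx hy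
    rw [hx, hy]
  have := (T.mem_edges.1 hF).2
  omega

theorem Choices.exists_isTri_patch (c : T.Choices) {F K : Finset Plane} (hF : F ∈ T.edges)
    (hK : K ∈ T.patch F) : ∃ z, IsTri K (c.endpoint F 0) (c.endpoint F 1) z := by
  obtain ⟨hK, hFK⟩ := T.mem_patch.1 hK
  exact exists_isTri_of_mem hK (hFK ((c.mem_edge_iff hF _).2 (Or.inl rfl)))
    (hFK ((c.mem_edge_iff hF _).2 (Or.inr rfl))) (c.endpoint_ne hF)

theorem patch_nonempty {F : Finset Plane} (hF : F ∈ T.edges) : (T.patch F).Nonempty := by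
  obtain ⟨K, hK, hcard, hFK⟩ := T.pure F (T.mem_edges.1 hF).1
  exact ⟨K, T.mem_patch.2 ⟨T.mem_elements.2 ⟨hK, hcard⟩, hFK⟩⟩

/-- A common point lies in the hull of the common vertices. There the coordinate of a vertex of `K₁`
missing from `K₂` vanishes, yet it is positive inside `K₁`. -/
theorem disjoint_cell {K₁ K₂ : Finset Plane} (h₁ : K₁ ∈ T.elements) (h₂ : K₂ ∈ T.elements)
    (hne : K₁ ≠ K₂) : Disjoint (cell K₁) (cell K₂) := by
  rw [Set.disjoint_left]
  intro x hx₁ hx₂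
  have hnot : ¬ K₁ ⊆ K₂ := fun hsub => hne (Finset.eq_of_subset_of_card_le hsub (by
    rw [(T.mem_elements.1 h₁).2, (T.mem_elements.1 h₂).2]))
  obtain ⟨a, ha₁, ha₂⟩ := Finset.not_subset.1 hnot
  obtain ⟨b, hb, hab⟩ := Finset.exists_mem_ne (by
    rw [(T.mem_elements.1 h₁).2]; norm_num : 1 < K₁.card) a
  obtain ⟨c, h⟩ := exists_isTri_of_mem h₁ ha₁ hb hab.symm
  have hmem := T.inter_subset_convexHull (T.mem_elements.1 h₁).1 (T.mem_elements.1 h₂).1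
    ⟨interior_subset hx₁, interior_subset hx₂⟩
  have hzero : convexHull ℝ ((K₁ : Set Plane) ∩ K₂) ⊆ bary K₁ a ⁻¹' {0} := by
    refine convexHull_min ?_ ((convex_singleton (0 : ℝ)).affine_preimage _)
    rintro y ⟨hy₁, hy₂⟩
    exact h.bary_of_ne hy₁ fun e => ha₂ (e ▸ hy₂)
  have h0 : bary K₁ a x = 0 := hzero hmem
  exact (h.mem_cell_iff.1 hx₁).1.ne' h0

/-- The one property of a Lipschitz domain that the argument needs: an open subset of `closure Ω`
lies in `Ω`. -/
theorem cell_subset (hΩ : interior (closure Ω) = Ω) {K : Finset Plane} (hK : K ∈ T.elements) :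
    cell K ⊆ Ω := by
  rw [← hΩ, ← T.space_eq]
  exact interior_mono (T.convexHull_subset_space (T.mem_elements.1 hK).1)

/-- A point of `Ω` in no open cell lies on the boundary of some triangle, and the frontier of a
convex set is null. -/
theorem volume_diff_iUnion_cell : volume (Ω \ ⋃ K ∈ T.elements, cell K) = 0 := by
  have hsub : Ω \ ⋃ K ∈ T.elements, cell K ⊆
      ⋃ K ∈ T.elements, frontier (convexHull ℝ (K : Set Plane)) := by
    rintro x ⟨hx, hxn⟩
    have hxs : x ∈ T.space := by
      rw [T.space_eq]
      exact subset_closure hx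
    obtain ⟨s, hs, hxs⟩ := Geometry.SimplicialComplex.mem_space_iff.1 hxs
    obtain ⟨K, hK, hcard, hsK⟩ := T.pure s hs
    have hKe : K ∈ T.elements := T.mem_elements.2 ⟨hK, hcard⟩
    simp only [Set.mem_iUnion, not_exists] at hxn ⊢
    exact ⟨K, hKe, subset_closure (convexHull_mono (by exact_mod_cast hsK) hxs), hxn K hKe⟩
  refine measure_mono_null hsub ?_
  refine (measure_biUnion_null_iff T.elements.countable_toSet).2 fun K _ => ?_
  exact (convex_convexHull ℝ _).addHaar_frontier volume

/-! ### Piecewise representatives -/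

/-- On each element `K` of the mesh, `v` coincides almost everywhere with `f K`. -/
def Represents (T : Mesh Ω) (v : Plane → ℝ) (f : Finset Plane → Plane → ℝ) : Prop :=
  ∀ K ∈ T.elements, v =ᵐ[volume.restrict (cell K)] f K

theorem Represents.eq {v w : Lp ℝ 2 (volume.restrict Ω)} {f : Finset Plane → Plane → ℝ}
    (hv : T.Represents v f) (hw : T.Represents w f) : v = w := by
  apply Lp.ext
  have h : ∀ᵐ x ∂(volume.restrict (⋃ K ∈ T.elements, cell K)), v x = w x := by
    have : (⋃ K ∈ T.elements, cell K) = ⋃ K : T.elements, cell (K : Finset Plane) := by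
      ext; simp
    rw [this, ae_restrict_iUnion_iff]
    exact fun K => (hv K K.2).trans (hw K K.2).symm
  have hm : MeasurableSet (⋃ K ∈ T.elements, cell K) :=
    T.elements.measurableSet_biUnion fun K _ => measurableSet_cell K
  rw [ae_restrict_iff' hm] at h
  have hnull : ∀ᵐ x ∂(volume.restrict Ω), x ∈ ⋃ K ∈ T.elements, cell K := by
    rw [ae_iff]
    change (volume.restrict Ω) (⋃ K ∈ T.elements, cell K)ᶜ = 0
    rw [Measure.restrict_apply hm.compl, Set.inter_comm]
    exact T.volume_diff_iUnion_cell
  filter_upwards [ae_restrict_of_ae h, hnull] with x hx hx' using hx hx'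

theorem ae_cell_of_ae (hΩ : interior (closure Ω) = Ω) {K : Finset Plane} (hK : K ∈ T.elements)
    {P : Plane → Prop} (h : ∀ᵐ x ∂(volume.restrict Ω), P x) :
    ∀ᵐ x ∂(volume.restrict (cell K)), P x :=
  ae_restrict_of_ae_restrict_of_subset (cell_subset hΩ hK) h

theorem glue_eq {f : Finset Plane → Plane → ℝ} {K : Finset Plane} (hK : K ∈ T.elements)
    {x : Plane} (hx : x ∈ cell K) : T.glue f x = f K x := by
  rw [glue, Finset.sum_eq_single_of_mem K hK, Set.indicator_of_mem hx]
  intro K' hK' hne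
  exact Set.indicator_of_notMem (fun h => Set.disjoint_left.1 (disjoint_cell hK' hK hne) h hx) _

theorem represents_glueLp (hΩ : interior (closure Ω) = Ω) {f : Finset Plane → Plane → ℝ}
    (hf : ∀ K, Continuous (f K)) : T.Represents (T.glueLp f hf) f := by
  intro K hK
  have h1 := ae_cell_of_ae hΩ hK (T.memLp_glue hf).coeFn_toLp
  filter_upwards [h1, ae_restrict_mem (measurableSet_cell K)] with x hx hxK
  rw [glueLp, hx, glue_eq hK hxK]

theorem represents_zero (hΩ : interior (closure Ω) = Ω) :
    T.Represents (0 : Lp ℝ 2 (volume.restrict Ω)) 0 :=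
  fun _ hK => ae_cell_of_ae hΩ hK (Lp.coeFn_zero ℝ 2 (volume.restrict Ω))

theorem Represents.add (hΩ : interior (closure Ω) = Ω) {v w : Lp ℝ 2 (volume.restrict Ω)}
    {f g : Finset Plane → Plane → ℝ} (hv : T.Represents v f) (hw : T.Represents w g) :
    T.Represents (v + w : Lp ℝ 2 (volume.restrict Ω)) (f + g) := by
  intro K hK
  filter_upwards [ae_cell_of_ae hΩ hK (Lp.coeFn_add v w), hv K hK, hw K hK] with x h1 h2 h3
  rw [h1, Pi.add_apply, h2, h3]
  rfl

theorem Represents.smul (hΩ : interior (closure Ω) = Ω) {v : Lp ℝ 2 (volume.restrict Ω)}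
    {f : Finset Plane → Plane → ℝ} (a : ℝ) (hv : T.Represents v f) :
    T.Represents (a • v : Lp ℝ 2 (volume.restrict Ω)) (a • f) := by
  intro K hK
  filter_upwards [ae_cell_of_ae hΩ hK (Lp.coeFn_smul a v), hv K hK] with x h1 h2
  rw [h1, Pi.smul_apply, h2]
  rfl

end Mesh

/-! ### Jumps across edges and the implicit space -/

/-- The point of the edge with endpoints `a`, `b` that corresponds to `s ∈ [-1, 1]`. -/
def edgePoint (a b : Plane) (s : ℝ) : Plane := AffineMap.lineMap a b ((s + 1) / 2)

theorem edgeLegendre_lineMap {a b : Plane} (hab : a ≠ b) (j : ℕ) (t : ℝ) :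
    edgeLegendre a b j (AffineMap.lineMap a b t) = (legendre j).eval (2 * t - 1) := by
  have hne : ‖b - a‖ ≠ 0 := norm_ne_zero_iff.2 (sub_ne_zero.2 hab.symm)
  have h : ⟪AffineMap.lineMap a b t - a, b - a⟫ / ‖b - a‖ ^ 2 = t := by
    rw [AffineMap.lineMap_apply, vsub_eq_sub, vadd_eq_add, add_sub_cancel_right,
      real_inner_smul_left, real_inner_self_eq_norm_sq]
    field_simp
  rw [edgeLegendre, h]

/-- The product over an edge, as an integral over `[-1, 1]`. -/
theorem edgeInner_edgeLegendre {a b : Plane} (hab : a ≠ b) (j : ℕ) {f g : Plane → ℝ}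
    (hfg : ∀ t ∈ Set.Icc (0 : ℝ) 1,
      f (AffineMap.lineMap a b t) = g (AffineMap.lineMap a b t)) :
    edgeInner a b f (edgeLegendre a b j) =
      dist a b * (2⁻¹ * ∫ s in (-1 : ℝ)..1, g (edgePoint a b s) * (legendre j).eval s) := by
  have h := intervalIntegral.integral_comp_mul_sub (a := 0) (b := 1)
    (fun s => g (edgePoint a b s) * (legendre j).eval s) (two_ne_zero (α := ℝ)) 1
  rw [edgeInner]
  congr 1
  rw [show (2 : ℝ) * 0 - 1 = -1 by norm_num, show (2 : ℝ) * 1 - 1 = 1 by norm_num,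
    smul_eq_mul] at h
  rw [← h]
  refine intervalIntegral.integral_congr fun t ht => ?_
  rw [Set.uIcc_of_le zero_le_one] at ht
  simp only [edgeLegendre_lineMap hab, hfg t ht, edgePoint]
  rw [show (2 * t - 1 + 1) / 2 = t by ring]

namespace Mesh

variable {Ω : Set Plane} {T : Mesh Ω}

/-- An edge belongs to at most two elements. -/
theorem Choices.eq_or_eq_of_mem_patch (c : T.Choices) {F K₁ K₂ K₃ : Finset Plane}
    (hF : F ∈ T.edges) (h₁ : K₁ ∈ T.patch F) (h₂ : K₂ ∈ T.patch F) (h₃ : K₃ ∈ T.patch F)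
    (h₁₂ : K₁ ≠ K₂) : K₃ = K₁ ∨ K₃ = K₂ := by
  by_contra! hne
  obtain ⟨z₁, t₁⟩ := c.exists_isTri_patch hF h₁
  obtain ⟨z₂, t₂⟩ := c.exists_isTri_patch hF h₂
  obtain ⟨z₃, t₃⟩ := c.exists_isTri_patch hF h₃
  have e₁ := (T.mem_patch.1 h₁).1
  have e₂ := (T.mem_patch.1 h₂).1
  have e₃ := (T.mem_patch.1 h₃).1
  -- Three triangles cannot lie pairwise on opposite sides of a line: the ratios satisfy `ρ = μ κ`,
  -- although all three are negative.
  obtain ⟨κ, hκ, heq⟩ := t₁.exists_neg_bary_eq t₂ (disjoint_cell e₁ e₂ h₁₂)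
  obtain ⟨μ, hμ, heq'⟩ := t₂.exists_neg_bary_eq t₃ (disjoint_cell e₂ e₃ hne.2.symm)
  obtain ⟨ρ, hρ, heq''⟩ := t₁.exists_neg_bary_eq t₃ (disjoint_cell e₁ e₃ hne.1.symm)
  have h := heq'' z₁
  rw [heq', heq, t₁.rotate.rotate.bary_self, mul_one, mul_one] at h
  have := mul_pos_of_neg_of_neg hμ hκ
  linarith

theorem Choices.exists_jump_eq (c : T.Choices) {F K₁ K₂ : Finset Plane} (hF : F ∈ T.edges)
    (h₁ : K₁ ∈ T.patch F) (h₂ : K₂ ∈ T.patch F) (hne : K₁ ≠ K₂) {v : Plane → ℝ}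
    {f : Finset Plane → Plane → ℝ} (hv : T.Represents v f)
    (hf : ∀ K ∈ T.elements, Continuous (f K)) :
    ∃ σ : ℝ, σ ≠ 0 ∧ ∀ t ∈ Set.Icc (0 : ℝ) 1,
      c.jump F v (AffineMap.lineMap (c.endpoint F 0) (c.endpoint F 1) t) =
        σ * (f K₁ (AffineMap.lineMap (c.endpoint F 0) (c.endpoint F 1) t) -
          f K₂ (AffineMap.lineMap (c.endpoint F 0) (c.endpoint F 1) t)) := by
  have e₁ := (T.mem_patch.1 h₁).1
  have e₂ := (T.mem_patch.1 h₂).1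
  obtain ⟨z₁, t₁⟩ := c.exists_isTri_patch hF h₁
  obtain ⟨z₂, t₂⟩ := c.exists_isTri_patch hF h₂
  have hmem := c.mem_edge_iff hF
  have horth : ⟪c.normal F, c.endpoint F 1 - c.endpoint F 0⟫ = 0 :=
    c.normal_orthogonal F hF _ ((hmem _).2 (Or.inl rfl)) _ ((hmem _).2 (Or.inr rfl))
  refine ⟨⟪outwardNormal K₁ F, c.normal F⟫,
    t₁.inner_outwardNormal_ne_zero hmem (c.normal_norm F hF) horth, fun t ht => ?_⟩
  rw [Choices.jump, Finset.sum_eq_add_of_mem K₁ K₂ h₁ h₂ hne,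
    trace_eq (hf K₁ e₁) (hv K₁ e₁)
      (t₁.convexHull_subset_closure_cell (t₁.lineMap_mem_convexHull ht)),
    trace_eq (hf K₂ e₂) (hv K₂ e₂)
      (t₂.convexHull_subset_closure_cell (t₂.lineMap_mem_convexHull ht)),
    t₁.outwardNormal_eq_neg t₂ (disjoint_cell e₁ e₂ hne) hmem, inner_neg_left]
  · ring
  · intro K hK hK'
    rcases c.eq_or_eq_of_mem_patch hF h₁ h₂ hK hne with h | h
    · exact absurd h hK'.1
    · exact absurd h hK'.2

/-- The piecewise polynomials of degree at most `p` whose jump on each edge `F` is a multiple of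
the Legendre polynomial `L_{p-1}^F`. -/
def Choices.jumpSpace (c : T.Choices) (p : ℕ) :
    Submodule ℝ (Finset Plane → Plane → ℝ) where
  carrier := {f | (∀ K ∈ T.elements, f K ∈ polyFun p) ∧
    ∀ F ∈ T.edges, ∀ K₁ ∈ T.patch F, ∀ K₂ ∈ T.patch F, ∃ γ : ℝ, ∀ s : ℝ,
      f K₁ (edgePoint (c.endpoint F 0) (c.endpoint F 1) s) -
        f K₂ (edgePoint (c.endpoint F 0) (c.endpoint F 1) s) = γ * (legendre (p - 1)).eval s}
  zero_mem' := ⟨fun _ _ => Submodule.zero_mem _, fun _ _ _ _ _ _ => ⟨0, by simp⟩⟩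
  add_mem' := by
    rintro f g ⟨hf, hf'⟩ ⟨hg, hg'⟩
    refine ⟨fun K hK => Submodule.add_mem _ (hf K hK) (hg K hK), fun F hF K₁ h₁ K₂ h₂ => ?_⟩
    obtain ⟨γ, hγ⟩ := hf' F hF K₁ h₁ K₂ h₂
    obtain ⟨δ, hδ⟩ := hg' F hF K₁ h₁ K₂ h₂
    refine ⟨γ + δ, fun s => ?_⟩
    simp only [Pi.add_apply]
    linear_combination hγ s + hδ s
  smul_mem' := by
    rintro a f ⟨hf, hf'⟩
    refine ⟨fun K hK => Submodule.smul_mem _ _ (hf K hK), fun F hF K₁ h₁ K₂ h₂ => ?_⟩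
    obtain ⟨γ, hγ⟩ := hf' F hF K₁ h₁ K₂ h₂
    refine ⟨a * γ, fun s => ?_⟩
    simp only [Pi.smul_apply, smul_eq_mul]
    linear_combination a * hγ s

/-- Legendre orthogonality in both directions: it leaves only the `L_{p-1}` component of the jump,
and such a component satisfies all the conditions. -/
theorem Choices.mem_implicitSpace_iff (c : T.Choices) {p : ℕ} (hp : 0 < p)
    {v : Lp ℝ 2 (volume.restrict Ω)} :
    v ∈ c.implicitSpace p ↔ ∃ f ∈ c.jumpSpace p, T.Represents v f := by
  constructor
  · rintro ⟨⟨-, hjump⟩, hpoly⟩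
    choose! f hf hvf using fun K hK => isPolyOn_iff.1 (hpoly K hK)
    have hcont : ∀ K ∈ T.elements, Continuous (f K) := fun K hK =>
      continuous_of_mem_polyFun (hf K hK)
    refine ⟨f, ⟨hf, fun F hF K₁ h₁ K₂ h₂ => ?_⟩, hvf⟩
    by_cases hne : K₁ = K₂
    · subst hne
      exact ⟨0, by simp⟩
    obtain ⟨σ, hσ, hj⟩ := c.exists_jump_eq hF h₁ h₂ hne hvf hcont
    have hab := c.endpoint_ne hF
    obtain ⟨q, hq, hfq⟩ := exists_eval_eq_on_line (c.endpoint F 0) (c.endpoint F 1)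
      (Submodule.sub_mem _ (hf K₁ (T.mem_patch.1 h₁).1) (hf K₂ (T.mem_patch.1 h₂).1))
    obtain ⟨γ, hγ⟩ := eq_C_mul_legendre_of_orthogonal (Nat.sub_le p 1) hq (fun j hj' hjp => by
      have h := hjump F ⟨hF, K₁, h₁, K₂, h₂, hne⟩ j hj' (by omega)
      rw [edgeInner_edgeLegendre hab j (g := fun x => σ * (f K₁ x - f K₂ x)) hj] at h
      simp_rw [mul_assoc σ] at h
      rw [intervalIntegral.integral_const_mul] at h
      have h' := (mul_eq_zero.1 ((mul_eq_zero.1 ((mul_eq_zero.1 h).resolve_left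
        (dist_ne_zero.2 hab))).resolve_left (by norm_num))).resolve_left hσ
      rw [← h']
      refine intervalIntegral.integral_congr fun s _ => ?_
      simp only [← hfq s]
      rfl)
    refine ⟨γ, fun s => ?_⟩
    have := hfq s
    rw [hγ, Polynomial.eval_mul, Polynomial.eval_C] at this
    exact this
  · rintro ⟨f, ⟨hf, hf'⟩, hvf⟩
    refine ⟨⟨fun K hK => memH1_of_contDiff (contDiff_of_mem_polyFun (hf K hK)) (hvf K hK), ?_⟩,
      fun K hK => isPolyOn_iff.2 ⟨f K, hf K hK, hvf K hK⟩⟩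
    rintro F ⟨hF, K₁, h₁, K₂, h₂, hne⟩ j - hjp
    obtain ⟨σ, -, hj⟩ := c.exists_jump_eq hF h₁ h₂ hne hvf fun K hK =>
      continuous_of_mem_polyFun (hf K hK)
    obtain ⟨γ, hγ⟩ := hf' F hF K₁ h₁ K₂ h₂
    rw [edgeInner_edgeLegendre (c.endpoint_ne hF) j (g := fun x => σ * (f K₁ x - f K₂ x)) hj]
    simp only [hγ, mul_assoc]
    -- Positivity of `p` is needed to pass from `j + 1 ≠ p` to `p - 1 ≠ j`, the subtraction being
    -- truncated.
    rw [intervalIntegral.integral_const_mul, intervalIntegral.integral_const_mul,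
      integral_legendre_mul_legendre_eq_zero (by omega)]
    simp

end Mesh

/-! ### Degrees and edge values of the explicit functions -/

theorem edgePoint_neg_one (a b : Plane) : edgePoint a b (-1) = a := by
  simp [edgePoint]

theorem edgePoint_one (a b : Plane) : edgePoint a b 1 = b := by
  norm_num [edgePoint]

namespace IsTri

variable {K F : Finset Plane} {a b c : Plane}

theorem bary_edgePoint_a (h : IsTri K a b c) (s : ℝ) :
    bary K a (edgePoint a b s) = (1 - s) / 2 := by
  rw [edgePoint, h.bary_lineMap_a]
  ring

theorem bary_edgePoint_b (h : IsTri K a b c) (s : ℝ) :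
    bary K b (edgePoint a b s) = (1 + s) / 2 := by
  rw [edgePoint, h.bary_lineMap_b]
  ring

theorem bary_edgePoint_c (h : IsTri K a b c) (s : ℝ) : bary K c (edgePoint a b s) = 0 := by
  rw [edgePoint, h.bary_lineMap_c]

theorem edge_cases (h : IsTri K a b c) (hFK : F ⊆ K) (hF : F.card = 2) :
    (∀ x, x ∈ F ↔ x = a ∨ x = b) ∨ (∀ x, x ∈ F ↔ x = b ∨ x = c) ∨
      (∀ x, x ∈ F ↔ x = c ∨ x = a) := by
  classical
  have h1 : (K \ F).card = 1 := by
    rw [Finset.card_sdiff_of_subset hFK, h.card_eq, hF]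
  obtain ⟨z, hz⟩ := Finset.card_eq_one.1 h1
  have hz' : ∀ x, (x ∈ K ∧ x ∉ F) ↔ x = z := fun x => by
    rw [← Finset.mem_sdiff, hz, Finset.mem_singleton]
  have hxF : ∀ x, x ∈ F ↔ x ∈ K ∧ x ≠ z := fun x => by
    have h2 := hz' x
    have h3 := @hFK x
    tauto
  have hab := h.ne_ab
  have hac := h.ne_ac
  have hbc := h.ne_bc
  rcases (h.mem_iff z).1 ((hz' z).2 rfl).1 with rfl | rfl | rfl
  · right; left
    intro x
    rw [hxF, h.mem_iff]
    grind
  · right; right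
    intro x
    rw [hxF, h.mem_iff]
    grind
  · left
    intro x
    rw [hxF, h.mem_iff]
    grind

theorem exists_isTri_edge (h : IsTri K a b c) (hFK : F ⊆ K) (hF : F.card = 2) :
    ∃ x y z, IsTri K x y z ∧ ∀ w, w ∈ F ↔ w = x ∨ w = y := by
  rcases h.edge_cases hFK hF with h' | h' | h'
  · exact ⟨a, b, c, h, h'⟩
  · exact ⟨b, c, a, h.rotate, h'⟩
  · exact ⟨c, a, b, h.rotate.rotate, h'⟩

theorem subset_of_edge (h : IsTri K a b c) (hF : ∀ x, x ∈ F ↔ x = a ∨ x = b) : F ⊆ K :=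
  fun x hx => (h.mem_iff x).2 (by rcases (hF x).1 hx with e | e <;> simp [e])

theorem edgeBubbleOn_eq (h : IsTri K a b c) (hF : ∀ x, x ∈ F ↔ x = a ∨ x = b) (m : ℕ)
    (x : Plane) : edgeBubbleOn m F K x = (legendre m).eval (1 - 2 * bary K c x) := by
  rw [edgeBubbleOn, if_pos (h.subset_of_edge hF), h.baryOpp_eq hF]

theorem edgeBubbleOn_edgePoint_self (h : IsTri K a b c) (hF : ∀ x, x ∈ F ↔ x = a ∨ x = b)
    (m : ℕ) (s : ℝ) : edgeBubbleOn m F K (edgePoint a b s) = 1 := by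
  rw [h.edgeBubbleOn_eq hF, h.bary_edgePoint_c, mul_zero, sub_zero, eval_one_legendre]

/-- On another edge of `K`, the coordinate opposite to `F` is `(1 ∓ s)/2`, so the bubble is
`L_m(±s)`, and the parity of `L_m` absorbs the sign. -/
theorem exists_edgeBubbleOn_edgePoint (h : IsTri K a b c) (hcard : F.card = 2)
    (hF : ¬ ∀ x, x ∈ F ↔ x = a ∨ x = b) (m : ℕ) :
    ∃ γ : ℝ, ∀ s, edgeBubbleOn m F K (edgePoint a b s) = γ * (legendre m).eval s := by
  by_cases hFK : F ⊆ K
  · rcases h.edge_cases hFK hcard with h' | h' | h'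
    · exact absurd h' hF
    · refine ⟨1, fun s => ?_⟩
      rw [h.rotate.edgeBubbleOn_eq h', h.bary_edgePoint_a, one_mul]
      ring_nf
    · refine ⟨(-1) ^ m, fun s => ?_⟩
      rw [h.rotate.rotate.edgeBubbleOn_eq h', h.bary_edgePoint_b, ← eval_neg_legendre]
      ring_nf
  · exact ⟨0, fun s => by rw [edgeBubbleOn, if_neg hFK, zero_mul]⟩

theorem edgeBubbleOn_mem_polyFun (h : IsTri K a b c) (hcard : F.card = 2) (m : ℕ) :
    edgeBubbleOn m F K ∈ polyFun m := by
  by_cases hFK : F ⊆ K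
  · obtain ⟨x, y, z, h', hF⟩ := h.exists_isTri_edge hFK hcard
    have hl := eval_comp_mem_polyFun
      (AffineMap.const ℝ Plane (1 : ℝ) - (2 : ℝ) • bary K z) (natDegree_legendre m).le
    have heq : edgeBubbleOn m F K = fun w =>
        (legendre m).eval ((AffineMap.const ℝ Plane (1 : ℝ) - (2 : ℝ) • bary K z) w) := by
      funext w
      rw [h'.edgeBubbleOn_eq hF]
      simp
    rw [heq]
    exact hl
  · have heq : edgeBubbleOn m F K = fun _ => 0 := by
      funext w
      rw [edgeBubbleOn, if_neg hFK]
    rw [heq]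
    exact const_mem_polyFun 0 m

/-- On the edge `λ_a λ_b = (1 - s²)/4`, which turns the `8` into `2`. The value does not involve
`K`, so the function has no jump there. -/
theorem modalEdgeOn_edgePoint_self (h : IsTri K a b c) (j : ℕ) (s : ℝ) :
    modalEdgeOn j a b K (edgePoint a b s) =
      2 * √(4 * j + 2) / (j * (j + 1)) *
        ((1 - s ^ 2) * (Polynomial.derivative (legendre j)).eval s) := by
  rw [modalEdgeOn, if_pos ⟨h.mem_a, h.mem_b⟩, h.bary_edgePoint_a, h.bary_edgePoint_b,
    show -((1 - s) / 2) + (1 + s) / 2 = s by ring]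
  ring

theorem modalEdgeOn_edgePoint_eq_zero (h : IsTri K a b c) {x y : Plane}
    (hF : ¬ ((x = a ∨ x = b) ∧ (y = a ∨ y = b))) (j : ℕ) (s : ℝ) :
    modalEdgeOn j x y K (edgePoint a b s) = 0 := by
  rw [modalEdgeOn]
  split_ifs with hK
  · rw [h.mem_iff, h.mem_iff] at hK
    have : x = c ∨ y = c := by tauto
    rcases this with rfl | rfl <;> simp [h.bary_edgePoint_c]
  · rfl

end IsTri

theorem modalEdgeOn_mem_polyFun (K : Finset Plane) (x y : Plane) {j p : ℕ} (hj : 1 ≤ j)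
    (hjp : j + 1 ≤ p) : modalEdgeOn j x y K ∈ polyFun p := by
  by_cases hK : x ∈ K ∧ y ∈ K
  · have hd : (Polynomial.derivative (legendre j)).natDegree ≤ j - 1 := by
      refine (Polynomial.natDegree_derivative_le _).trans ?_
      rw [natDegree_legendre]
    have hl := eval_comp_mem_polyFun (-bary K x + bary K y) hd
    have hmul := mul_mem_polyFun
      (mul_mem_polyFun (coe_mem_polyFun (bary K x)) (coe_mem_polyFun (bary K y))) hl
    have heq : modalEdgeOn j x y K = (8 * √(4 * j + 2) / (j * (j + 1))) •
        ((bary K x : Plane → ℝ) * bary K y * fun w =>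
          (Polynomial.derivative (legendre j)).eval ((-bary K x + bary K y) w)) := by
      funext w
      rw [modalEdgeOn, if_pos hK]
      simp [mul_assoc]
    rw [heq]
    exact Submodule.smul_mem _ _ (polyFun_mono (by omega) hmul)
  · have heq : modalEdgeOn j x y K = fun _ => 0 := by
      funext w
      rw [modalEdgeOn, if_neg hK]
    rw [heq]
    exact const_mem_polyFun 0 p

theorem modalElementOn_mem_polyFun (K K' : Finset Plane) (ν : Fin 3 → Plane) {r₁ r₂ p : ℕ}
    (hr : r₁ + r₂ + 3 ≤ p) : modalElementOn r₁ r₂ K ν K' ∈ polyFun p := by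
  by_cases hK : K' = K
  · have h1 := eval_comp_mem_polyFun (bary K (ν 1) - bary K (ν 0)) (natDegree_legendre r₁).le
    have h2 := eval_comp_mem_polyFun ((2 : ℝ) • bary K (ν 2) - AffineMap.const ℝ Plane (1 : ℝ))
      (natDegree_legendre r₂).le
    have h3 := mul_mem_polyFun (mul_mem_polyFun
      (mul_mem_polyFun (mul_mem_polyFun (coe_mem_polyFun (bary K (ν 0)))
        (coe_mem_polyFun (bary K (ν 1)))) (coe_mem_polyFun (bary K (ν 2)))) h1) h2
    refine polyFun_mono (by omega : 1 + 1 + 1 + r₁ + r₂ ≤ p) ?_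
    convert h3 using 1
    funext w
    rw [modalElementOn, if_pos hK]
    simp
  · have heq : modalElementOn r₁ r₂ K ν K' = fun _ => 0 := by
      funext w
      rw [modalElementOn, if_neg hK]
    rw [heq]
    exact const_mem_polyFun 0 p

/-! ### The explicit space and its inclusion in the jump space -/

namespace Mesh

variable {Ω : Set Plane} {T : Mesh Ω}

/-- The span of the basis functions of the explicit space, given elementwise by polynomials. -/
def Choices.explicitFun (c : T.Choices) (p : ℕ) : Submodule ℝ (Finset Plane → Plane → ℝ) :=
  Submodule.span ℝ
    ({f | ∃ F ∈ T.edges, f = edgeBubbleOn (p - 1) F} ∪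
      {f | ∃ F ∈ T.edges, ∃ j : ℕ, 1 ≤ j ∧ j + 1 ≤ p ∧
        f = modalEdgeOn j (c.endpoint F 0) (c.endpoint F 1)} ∪
      {f | ∃ K ∈ T.elements, ∃ r₁ r₂ : ℕ, r₁ + r₂ + 3 ≤ p ∧
        f = modalElementOn r₁ r₂ K (c.vertex K)})

theorem Choices.edgeBubbleOn_mem (c : T.Choices) {p : ℕ} {F : Finset Plane} (hF : F ∈ T.edges) :
    edgeBubbleOn (p - 1) F ∈ c.explicitFun p :=
  Submodule.subset_span (Or.inl (Or.inl ⟨F, hF, rfl⟩))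

theorem Choices.modalEdgeOn_mem (c : T.Choices) {p j : ℕ} {F : Finset Plane} (hF : F ∈ T.edges)
    (hj : 1 ≤ j) (hjp : j + 1 ≤ p) :
    modalEdgeOn j (c.endpoint F 0) (c.endpoint F 1) ∈ c.explicitFun p :=
  Submodule.subset_span (Or.inl (Or.inr ⟨F, hF, j, hj, hjp, rfl⟩))

theorem Choices.modalElementOn_mem (c : T.Choices) {p r₁ r₂ : ℕ} {K : Finset Plane}
    (hK : K ∈ T.elements) (hr : r₁ + r₂ + 3 ≤ p) :
    modalElementOn r₁ r₂ K (c.vertex K) ∈ c.explicitFun p :=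
  Submodule.subset_span (Or.inr ⟨K, hK, r₁, r₂, hr, rfl⟩)

/-- With the converse `exists_explicitSpace`, this moves the problem from `L²` classes to genuine
functions, where restriction to an edge makes sense. -/
theorem Choices.exists_explicitFun (hΩ : interior (closure Ω) = Ω) (c : T.Choices) {p : ℕ}
    {v : Lp ℝ 2 (volume.restrict Ω)} (hv : v ∈ c.explicitSpace p) :
    ∃ f ∈ c.explicitFun p, T.Represents v f := by
  induction hv using Submodule.span_induction with
  | mem v hv =>
    rcases hv with (⟨F, hF, rfl⟩ | ⟨F, hF, j, hj, hjp, rfl⟩) | ⟨K, hK, r₁, r₂, hr, rfl⟩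
    · exact ⟨_, c.edgeBubbleOn_mem hF, represents_glueLp hΩ _⟩
    · exact ⟨_, c.modalEdgeOn_mem hF hj hjp, represents_glueLp hΩ _⟩
    · exact ⟨_, c.modalElementOn_mem hK hr, represents_glueLp hΩ _⟩
  | zero => exact ⟨0, Submodule.zero_mem _, represents_zero hΩ⟩
  | add v w _ _ hv hw =>
    obtain ⟨f, hf, hvf⟩ := hv
    obtain ⟨g, hg, hwg⟩ := hw
    exact ⟨f + g, Submodule.add_mem _ hf hg, hvf.add hΩ hwg⟩
  | smul a v _ hv =>
    obtain ⟨f, hf, hvf⟩ := hv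
    exact ⟨a • f, Submodule.smul_mem _ a hf, hvf.smul hΩ a⟩

theorem Choices.exists_explicitSpace (hΩ : interior (closure Ω) = Ω) (c : T.Choices) {p : ℕ}
    {f : Finset Plane → Plane → ℝ} (hf : f ∈ c.explicitFun p) :
    ∃ v ∈ c.explicitSpace p, T.Represents v f := by
  induction hf using Submodule.span_induction with
  | mem f hf =>
    rcases hf with (⟨F, hF, rfl⟩ | ⟨F, hF, j, hj, hjp, rfl⟩) | ⟨K, hK, r₁, r₂, hr, rfl⟩
    · exact ⟨_, Submodule.subset_span (Or.inl (Or.inl ⟨F, hF, rfl⟩)),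
        represents_glueLp hΩ (continuous_edgeBubbleOn _ _)⟩
    · exact ⟨_, Submodule.subset_span (Or.inl (Or.inr ⟨F, hF, j, hj, hjp, rfl⟩)),
        represents_glueLp hΩ (continuous_modalEdgeOn _ _ _)⟩
    · exact ⟨_, Submodule.subset_span (Or.inr ⟨K, hK, r₁, r₂, hr, rfl⟩),
        represents_glueLp hΩ (continuous_modalElementOn _ _ _ _)⟩
  | zero => exact ⟨0, Submodule.zero_mem _, represents_zero hΩ⟩
  | add f g _ _ hf hg =>
    obtain ⟨v, hv, hvf⟩ := hf
    obtain ⟨w, hw, hwg⟩ := hg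
    exact ⟨v + w, Submodule.add_mem _ hv hw, hvf.add hΩ hwg⟩
  | smul a f _ hf =>
    obtain ⟨v, hv, hvf⟩ := hf
    exact ⟨a • v, Submodule.smul_mem _ a hv, hvf.smul hΩ a⟩

theorem Choices.edge_eq_of_mem_iff (c : T.Choices) {F F' : Finset Plane} (hF : F ∈ T.edges)
    (h : ∀ x, x ∈ F' ↔ x = c.endpoint F 0 ∨ x = c.endpoint F 1) : F' = F := by
  ext x
  rw [h, c.mem_edge_iff hF]

theorem Choices.modalEdgeOn_eq_zero (c : T.Choices) {F F' K : Finset Plane} (hF : F ∈ T.edges)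
    (hF' : F' ∈ T.edges) (hne : F' ≠ F) (hK : K ∈ T.patch F) (j : ℕ) (s : ℝ) :
    modalEdgeOn j (c.endpoint F' 0) (c.endpoint F' 1) K
      (edgePoint (c.endpoint F 0) (c.endpoint F 1) s) = 0 := by
  obtain ⟨z, t⟩ := c.exists_isTri_patch hF hK
  refine t.modalEdgeOn_edgePoint_eq_zero (fun h => hne ?_) j s
  rw [← c.mem_edge_iff hF, ← c.mem_edge_iff hF] at h
  refine Finset.eq_of_subset_of_card_le (fun x hx => ?_) (by
    rw [(T.mem_edges.1 hF).2, (T.mem_edges.1 hF').2])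
  rcases (c.mem_edge_iff hF' x).1 hx with rfl | rfl
  exacts [h.1, h.2]

theorem Choices.modalElementOn_eq_zero (c : T.Choices) {F K K' : Finset Plane} (hF : F ∈ T.edges)
    (hK' : K' ∈ T.elements) (hK : K ∈ T.patch F) (r₁ r₂ : ℕ) (s : ℝ) :
    modalElementOn r₁ r₂ K' (c.vertex K') K
      (edgePoint (c.endpoint F 0) (c.endpoint F 1) s) = 0 := by
  rw [modalElementOn]
  split_ifs with h
  · subst h
    obtain ⟨z, t⟩ := c.exists_isTri_patch hF hK
    have hz := t.bary_edgePoint_c s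
    rcases ((c.isTri hK').mem_iff z).1 t.mem_c with e | e | e <;> rw [e] at hz <;> simp [hz]
  · rfl

/-- Only edge bubbles jump, and only across edges other than their own, where each side is a
multiple of `L_{p-1}`. The parity of `p` plays no role here. -/
theorem Choices.explicitFun_le_jumpSpace (c : T.Choices) (p : ℕ) :
    c.explicitFun p ≤ c.jumpSpace p := by
  refine Submodule.span_le.2 ?_
  rintro f ((⟨F', hF', rfl⟩ | ⟨F', hF', j, hj, hjp, rfl⟩) | ⟨K', hK', r₁, r₂, hr, rfl⟩)
  · refine ⟨fun K hK => ?_, fun F hF K₁ h₁ K₂ h₂ => ?_⟩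
    · obtain ⟨x, y, z, h⟩ := exists_isTri_of_mem_elements hK
      exact polyFun_mono (Nat.sub_le p 1) (h.edgeBubbleOn_mem_polyFun (T.mem_edges.1 hF').2 _)
    · obtain ⟨z₁, t₁⟩ := c.exists_isTri_patch hF h₁
      obtain ⟨z₂, t₂⟩ := c.exists_isTri_patch hF h₂
      by_cases hFF' : F' = F
      · subst hFF'
        refine ⟨0, fun s => ?_⟩
        rw [t₁.edgeBubbleOn_edgePoint_self (c.mem_edge_iff hF),
          t₂.edgeBubbleOn_edgePoint_self (c.mem_edge_iff hF)]
        ring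
      · have hn := fun h => hFF' (c.edge_eq_of_mem_iff hF h)
        obtain ⟨γ₁, hγ₁⟩ := t₁.exists_edgeBubbleOn_edgePoint (T.mem_edges.1 hF').2 hn (p - 1)
        obtain ⟨γ₂, hγ₂⟩ := t₂.exists_edgeBubbleOn_edgePoint (T.mem_edges.1 hF').2 hn (p - 1)
        refine ⟨γ₁ - γ₂, fun s => ?_⟩
        rw [hγ₁, hγ₂]
        ring
  · refine ⟨fun K _ => modalEdgeOn_mem_polyFun _ _ _ hj hjp,
      fun F hF K₁ h₁ K₂ h₂ => ⟨0, fun s => ?_⟩⟩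
    by_cases hFF' : F' = F
    · subst hFF'
      obtain ⟨z₁, t₁⟩ := c.exists_isTri_patch hF h₁
      obtain ⟨z₂, t₂⟩ := c.exists_isTri_patch hF h₂
      rw [t₁.modalEdgeOn_edgePoint_self, t₂.modalEdgeOn_edgePoint_self]
      ring
    · rw [c.modalEdgeOn_eq_zero hF hF' hFF' h₁, c.modalEdgeOn_eq_zero hF hF' hFF' h₂]
      ring
  · refine ⟨fun K _ => modalElementOn_mem_polyFun _ _ _ hr,
      fun F hF K₁ h₁ K₂ h₂ => ⟨0, fun s => ?_⟩⟩
    rw [c.modalElementOn_eq_zero hF hK' h₁, c.modalElementOn_eq_zero hF hK' h₂]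
    ring

end Mesh

/-! ### Decomposition by vertices, edges and elements -/

/-- A polynomial vanishing on the three edges of a triangle is divisible by the cubic bubble. -/
theorem IsTri.exists_eq_bubble_mul {K : Finset Plane} {a b c : Plane} (h : IsTri K a b c) {p : ℕ}
    (hp : 2 ≤ p) {f : Plane → ℝ} (hf : f ∈ polyFun p)
    (hab : ∀ t : ℝ, f (AffineMap.lineMap a b t) = 0)
    (hbc : ∀ t : ℝ, f (AffineMap.lineMap b c t) = 0)
    (hca : ∀ t : ℝ, f (AffineMap.lineMap c a t) = 0) :
    ∃ k : Plane → ℝ, (p = 2 → k = 0) ∧ (3 ≤ p → k ∈ polyFun (p - 3)) ∧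
      ∀ x, f x = bary K a x * bary K b x * bary K c x * k x := by
  obtain ⟨n, rfl⟩ : ∃ n, p = n + 2 := ⟨p - 2, by omega⟩
  -- Divide in turn by `λ_a`, `λ_b`, `λ_c`. In the relative interior of an edge the factors already
  -- removed are nonzero, so the quotient still vanishes there.
  obtain ⟨g₁, hg₁, -, hfg₁⟩ := exists_eq_mul_of_eq_zero h.affineCoords hf fun τ _ =>
    ⟨AffineMap.lineMap b c (1 - τ), h.rotate.bary_lineMap_c _,
      by rw [h.rotate.bary_lineMap_a]; ring, hbc _⟩
  have hg₁0 : ∀ τ ∈ Set.Ioo (0 : ℝ) 1, ∃ x, bary K b x = 0 ∧ bary K c x = τ ∧ g₁ x = 0 := by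
    intro τ hτ
    have h0 := hca (1 - τ)
    rw [hfg₁, h.rotate.rotate.bary_lineMap_b] at h0
    exact ⟨_, h.rotate.rotate.bary_lineMap_c (1 - τ), by
      rw [h.rotate.rotate.bary_lineMap_a]; ring,
      (mul_eq_zero.1 h0).resolve_left (by linarith [hτ.2])⟩
  obtain ⟨g₂, hg₂, -, hfg₂⟩ := exists_eq_mul_of_eq_zero h.rotate.affineCoords
    (hg₁ (n + 1) rfl) hg₁0
  have hg₂0 : ∀ τ ∈ Set.Ioo (0 : ℝ) 1, ∃ x, bary K c x = 0 ∧ bary K a x = τ ∧ g₂ x = 0 := by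
    intro τ hτ
    have h0 := hab (1 - τ)
    rw [hfg₁, hfg₂, h.bary_lineMap_a, h.bary_lineMap_b] at h0
    exact ⟨_, h.bary_lineMap_c (1 - τ), by rw [h.bary_lineMap_a]; ring,
      (mul_eq_zero.1 ((mul_eq_zero.1 h0).resolve_left (by linarith [hτ.1]))).resolve_left
        (by linarith [hτ.2])⟩
  obtain ⟨k, hk, hk0, hfk⟩ := exists_eq_mul_of_eq_zero h.rotate.rotate.affineCoords
    (hg₂ n rfl) hg₂0
  refine ⟨k, fun hn => hk0 (by omega), fun hn => hk _ (by omega), fun x => ?_⟩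
  rw [hfg₁, hfg₂, hfk]
  ring

namespace Mesh

variable {Ω : Set Plane} {T : Mesh Ω}

theorem pair_mem_edges {K : Finset Plane} (hK : K ∈ T.elements) {a b : Plane} (ha : a ∈ K)
    (hb : b ∈ K) (hab : a ≠ b) :
    ∃ F ∈ T.edges, K ∈ T.patch F ∧ ∀ x, x ∈ F ↔ x = a ∨ x = b := by
  classical
  have hsub : ({a, b} : Finset Plane) ⊆ K := by
    intro x hx
    rcases Finset.mem_insert.1 hx with rfl | hx
    · exact ha
    · rwa [Finset.mem_singleton.1 hx]
  refine ⟨{a, b}, T.mem_edges.2 ⟨T.down_closed (T.mem_elements.1 hK).1 hsub ⟨a, by simp⟩,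
    Finset.card_pair hab⟩, T.mem_patch.2 ⟨hK, hsub⟩, fun x => by simp⟩

theorem sum_edges_eq {K : Finset Plane} {a b c : Plane} (h : IsTri K a b c)
    {F₁ F₂ F₃ : Finset Plane} (e₁ : F₁ ∈ T.edges) (e₂ : F₂ ∈ T.edges) (e₃ : F₃ ∈ T.edges)
    (h₁ : ∀ x, x ∈ F₁ ↔ x = a ∨ x = b) (h₂ : ∀ x, x ∈ F₂ ↔ x = b ∨ x = c)
    (h₃ : ∀ x, x ∈ F₃ ↔ x = c ∨ x = a) {g : Finset Plane → ℝ} (hg : ∀ F, ¬ F ⊆ K → g F = 0) :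
    ∑ F ∈ T.edges, g F = g F₁ + g F₂ + g F₃ := by
  classical
  have n₁₂ : F₁ ≠ F₂ := fun e => by
    have := (h₂ a).1 (e ▸ (h₁ a).2 (Or.inl rfl))
    exact this.elim h.ne_ab h.ne_ac
  have n₁₃ : F₁ ≠ F₃ := fun e => by
    have := (h₃ b).1 (e ▸ (h₁ b).2 (Or.inr rfl))
    exact this.elim h.ne_bc h.ne_ab.symm
  have n₂₃ : F₂ ≠ F₃ := fun e => by
    have := (h₃ b).1 (e ▸ (h₂ b).2 (Or.inl rfl))
    exact this.elim h.ne_bc h.ne_ab.symm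
  have hsub : ({F₁, F₂, F₃} : Finset (Finset Plane)) ⊆ T.edges := by
    intro F hF
    simp only [Finset.mem_insert, Finset.mem_singleton] at hF
    rcases hF with rfl | rfl | rfl <;> assumption
  rw [← Finset.sum_subset hsub, Finset.sum_insert (by simp [n₁₂, n₁₃]), Finset.sum_pair n₂₃,
    add_assoc]
  intro F hF hFn
  refine hg F fun hFK => hFn ?_
  simp only [Finset.mem_insert, Finset.mem_singleton]
  rcases h.edge_cases hFK (T.mem_edges.1 hF).2 with h' | h' | h'
  · exact Or.inl (Finset.ext fun x => by rw [h', h₁])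
  · exact Or.inr (Or.inl (Finset.ext fun x => by rw [h', h₂]))
  · exact Or.inr (Or.inr (Finset.ext fun x => by rw [h', h₃]))

/-- The sum of the two endpoint values of a function in the jump space is single-valued on each
edge. -/
theorem Choices.exists_endpoint_sum (c : T.Choices) {p : ℕ} (hp : Odd (p - 1))
    {f : Finset Plane → Plane → ℝ} (hf : f ∈ c.jumpSpace p) {F : Finset Plane}
    (hF : F ∈ T.edges) :
    ∃ α : ℝ, ∀ K ∈ T.patch F, ∀ a b, a ≠ b → (∀ x, x ∈ F ↔ x = a ∨ x = b) →
      f K a + f K b = 2 * α := by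
  obtain ⟨K₀, h₀⟩ := patch_nonempty hF
  refine ⟨(f K₀ (c.endpoint F 0) + f K₀ (c.endpoint F 1)) / 2, fun K hK a b hab hmem => ?_⟩
  obtain ⟨γ, hγ⟩ := hf.2 F hF K hK K₀ h₀
  have h1 := hγ 1
  have h2 := hγ (-1)
  rw [edgePoint_one, eval_one_legendre] at h1
  -- This is where the evenness of `p` enters: the jumps at the two ends are `γ` and `-γ`, and they
  -- cancel in the sum.
  rw [edgePoint_neg_one, eval_neg_one_legendre, hp.neg_one_pow] at h2
  have ha := (c.mem_edge_iff hF a).1 ((hmem a).2 (Or.inl rfl))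
  have hb := (c.mem_edge_iff hF b).1 ((hmem b).2 (Or.inr rfl))
  rcases ha with rfl | rfl <;> rcases hb with rfl | rfl
  · exact absurd rfl hab
  · linarith
  · linarith
  · exact absurd rfl hab

/-- The values at the vertices are matched by a combination of edge bubbles. -/
theorem Choices.exists_eq_at_vertices (c : T.Choices) {p : ℕ} (hp : Odd (p - 1))
    {f : Finset Plane → Plane → ℝ} (hf : f ∈ c.jumpSpace p) :
    ∃ g ∈ c.explicitFun p, ∀ K ∈ T.elements, ∀ x ∈ K, f K x = g K x := by
  choose! α hα using fun F hF => c.exists_endpoint_sum hp hf (F := F) hF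
  refine ⟨∑ F ∈ T.edges, α F • edgeBubbleOn (p - 1) F,
    Submodule.sum_mem _ fun F hF => Submodule.smul_mem _ _ (c.edgeBubbleOn_mem hF),
    fun K hK a ha => ?_⟩
  obtain ⟨b, hb, hab⟩ := Finset.exists_mem_ne (by
    rw [(T.mem_elements.1 hK).2]; norm_num : 1 < K.card) a
  obtain ⟨z, t⟩ := exists_isTri_of_mem hK ha hb hab.symm
  obtain ⟨F₁, e₁, p₁, h₁⟩ := pair_mem_edges hK t.mem_a t.mem_b t.ne_ab
  obtain ⟨F₂, e₂, p₂, h₂⟩ := pair_mem_edges hK t.mem_b t.mem_c t.ne_bc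
  obtain ⟨F₃, e₃, p₃, h₃⟩ := pair_mem_edges hK t.mem_c t.mem_a t.ne_ac.symm
  have hsum := sum_edges_eq t e₁ e₂ e₃ h₁ h₂ h₃
    (g := fun F => α F * edgeBubbleOn (p - 1) F K a) fun F hFK => by
      rw [edgeBubbleOn, if_neg hFK, mul_zero]
  have hval : (∑ F ∈ T.edges, α F • edgeBubbleOn (p - 1) F) K a =
      ∑ F ∈ T.edges, α F * edgeBubbleOn (p - 1) F K a := by
    simp [Finset.sum_apply]
  rw [hval, hsum, t.edgeBubbleOn_eq h₁, t.rotate.edgeBubbleOn_eq h₂,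
    t.rotate.rotate.edgeBubbleOn_eq h₃, t.bary_self, t.bary_of_ne t.mem_a t.ne_ab,
    t.bary_of_ne t.mem_a t.ne_ac, mul_zero, sub_zero, eval_one_legendre,
    show (1 : ℝ) - 2 * 1 = -1 by norm_num, eval_neg_one_legendre, hp.neg_one_pow]
  -- At `a` the combination is `α₁ - α₂ + α₃`, which is half of `(f a + f b) - (f b + f z) + (f z +
  -- f a)`, that is `f a`.
  have r₁ := hα F₁ e₁ K p₁ _ _ t.ne_ab h₁
  have r₂ := hα F₂ e₂ K p₂ _ _ t.ne_bc h₂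
  have r₃ := hα F₃ e₃ K p₃ _ _ t.ne_ac.symm h₃
  linarith

/-- The modal edge functions of an edge span the polynomials on it that vanish at the endpoints. -/
theorem Choices.exists_eq_on_edge (c : T.Choices) {p : ℕ} (hp : 2 ≤ p) {F : Finset Plane}
    (hF : F ∈ T.edges) {r : Polynomial ℝ} (hr : r.natDegree ≤ p - 2) :
    ∃ g ∈ c.explicitFun p,
      (∀ K ∈ T.patch F, ∀ s, g K (edgePoint (c.endpoint F 0) (c.endpoint F 1) s) =
        (1 - s ^ 2) * r.eval s) ∧
      ∀ F' ∈ T.edges, F ≠ F' → ∀ K ∈ T.patch F', ∀ s,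
        g K (edgePoint (c.endpoint F' 0) (c.endpoint F' 1) s) = 0 := by
  have hspan := mem_span_of_degree_eq degree_derivative_legendre hr
  clear hr
  induction hspan using Submodule.span_induction with
  | mem r hr =>
    obtain ⟨j, hj, rfl⟩ := hr
    have hj' : j ≤ p - 2 := hj
    -- The factor of the modal function of index `j + 1` on its edge. Since `L_{j+1}'` has degree
    -- `j`, the range `j ≤ p - 2` gives exactly the indices `1, …, p - 1`.
    set C : ℝ := 2 * √(4 * (j + 1 : ℕ) + 2) / ((j + 1 : ℕ) * ((j + 1 : ℕ) + 1)) with hC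
    have hC0 : C ≠ 0 := by positivity
    refine ⟨C⁻¹ • modalEdgeOn (j + 1) (c.endpoint F 0) (c.endpoint F 1),
      Submodule.smul_mem _ _ (c.modalEdgeOn_mem hF (by omega) (by omega)), fun K hK s => ?_,
      fun F' hF' hne K hK s => ?_⟩
    · obtain ⟨z, t⟩ := c.exists_isTri_patch hF hK
      rw [Pi.smul_apply, Pi.smul_apply, t.modalEdgeOn_edgePoint_self, smul_eq_mul, ← hC,
        inv_mul_cancel_left₀ hC0]
    · rw [Pi.smul_apply, Pi.smul_apply, c.modalEdgeOn_eq_zero hF' hF hne hK, smul_zero]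
  | zero =>
    exact ⟨0, Submodule.zero_mem _, by simp, by simp⟩
  | add r r' _ _ hr hr' =>
    obtain ⟨g, hg, h1, h2⟩ := hr
    obtain ⟨g', hg', h1', h2'⟩ := hr'
    refine ⟨g + g', Submodule.add_mem _ hg hg', fun K hK s => ?_, fun F' hF' hne K hK s => ?_⟩
    · rw [Pi.add_apply, Pi.add_apply, h1 K hK, h1' K hK, Polynomial.eval_add]
      ring
    · rw [Pi.add_apply, Pi.add_apply, h2 F' hF' hne K hK, h2' F' hF' hne K hK, add_zero]
  | smul a r _ hr =>
    obtain ⟨g, hg, h1, h2⟩ := hr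
    refine ⟨a • g, Submodule.smul_mem _ _ hg, fun K hK s => ?_, fun F' hF' hne K hK s => ?_⟩
    · rw [Pi.smul_apply, Pi.smul_apply, h1 K hK, Polynomial.eval_smul]
      simp only [smul_eq_mul]
      ring
    · rw [Pi.smul_apply, Pi.smul_apply, h2 F' hF' hne K hK, smul_zero]

/-- The values on the edges of a function in the jump space that vanishes at the vertices are
matched by a combination of modal edge functions. -/
theorem Choices.exists_eq_on_edges (c : T.Choices) {p : ℕ} (hp : 2 ≤ p)
    {f : Finset Plane → Plane → ℝ} (hf : f ∈ c.jumpSpace p)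
    (hf0 : ∀ K ∈ T.elements, ∀ x ∈ K, f K x = 0) :
    ∃ g ∈ c.explicitFun p, ∀ F ∈ T.edges, ∀ K ∈ T.patch F, ∀ s,
      f K (edgePoint (c.endpoint F 0) (c.endpoint F 1) s) =
        g K (edgePoint (c.endpoint F 0) (c.endpoint F 1) s) := by
  have hedge : ∀ F ∈ T.edges, ∃ g ∈ c.explicitFun p,
      (∀ K ∈ T.patch F, ∀ s, f K (edgePoint (c.endpoint F 0) (c.endpoint F 1) s) =
        g K (edgePoint (c.endpoint F 0) (c.endpoint F 1) s)) ∧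
      ∀ F' ∈ T.edges, F ≠ F' → ∀ K ∈ T.patch F', ∀ s,
        g K (edgePoint (c.endpoint F' 0) (c.endpoint F' 1) s) = 0 := by
    intro F hF
    obtain ⟨K₀, h₀⟩ := patch_nonempty hF
    have hval : ∀ K ∈ T.patch F, f K (c.endpoint F 0) = 0 ∧ f K (c.endpoint F 1) = 0 := by
      intro K hK
      obtain ⟨z, t⟩ := c.exists_isTri_patch hF hK
      have hKe := (T.mem_patch.1 hK).1
      exact ⟨hf0 K hKe _ t.mem_a, hf0 K hKe _ t.mem_b⟩
    obtain ⟨q, hq, hfq⟩ := exists_eval_eq_on_line (c.endpoint F 0) (c.endpoint F 1)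
      (hf.1 K₀ (T.mem_patch.1 h₀).1)
    have hq1 : q.eval 1 = 0 := by
      rw [← hfq 1]
      exact (congrArg (f K₀) (edgePoint_one _ _)).trans (hval K₀ h₀).2
    have hq2 : q.eval (-1) = 0 := by
      rw [← hfq (-1)]
      exact (congrArg (f K₀) (edgePoint_neg_one _ _)).trans (hval K₀ h₀).1
    obtain ⟨r, hr, rfl⟩ := exists_eq_mul_of_eval_eq_zero hp hq hq1 hq2
    obtain ⟨g, hg, h1, h2⟩ := c.exists_eq_on_edge hp hF hr
    refine ⟨g, hg, fun K hK s => ?_, h2⟩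
    obtain ⟨γ, hγ⟩ := hf.2 F hF K hK K₀ h₀
    -- The jump `γ L_{p-1}` equals `γ` at `s = 1`, where both sides vanish. Hence `γ = 0`, and the
    -- polynomial found on `K₀` serves every element of the patch.
    have hγ1 := hγ 1
    rw [edgePoint_one, (hval K hK).2, (hval K₀ h₀).2, eval_one_legendre] at hγ1
    have hs := hγ s
    rw [show γ = 0 by linarith, zero_mul, sub_eq_zero] at hs
    rw [hs, h1 K hK]
    refine (hfq s).trans ?_
    simp
  choose! g hg h1 h2 using hedge
  refine ⟨∑ F ∈ T.edges, g F, Submodule.sum_mem _ hg, fun F hF K hK s => ?_⟩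
  rw [Finset.sum_apply, Finset.sum_apply, Finset.sum_eq_single_of_mem F hF fun F' hF' hne =>
    h2 F' hF' F hF hne K hK s]
  exact h1 F hF K hK s

/-- A piecewise polynomial supported on one element and vanishing on its edges is a combination
of the element bubbles. -/
theorem Choices.exists_eq_on_element (c : T.Choices) {p : ℕ} (hp : 2 ≤ p) {K : Finset Plane}
    (hK : K ∈ T.elements) {f : Plane → ℝ} (hf : f ∈ polyFun p)
    (h01 : ∀ t : ℝ, f (AffineMap.lineMap (c.vertex K 0) (c.vertex K 1) t) = 0)
    (h12 : ∀ t : ℝ, f (AffineMap.lineMap (c.vertex K 1) (c.vertex K 2) t) = 0)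
    (h20 : ∀ t : ℝ, f (AffineMap.lineMap (c.vertex K 2) (c.vertex K 0) t) = 0) :
    ∃ g ∈ c.explicitFun p, g K = f ∧ ∀ K', K' ≠ K → g K' = 0 := by
  have t := c.isTri hK
  obtain ⟨k, hk2, hk3, hfk⟩ := t.exists_eq_bubble_mul hp hf h01 h12 h20
  -- For `p = 2` there are no element bubbles, and the cofactor `k` is zero.
  rcases hp.eq_or_lt with h2 | h3
  · refine ⟨0, Submodule.zero_mem _, ?_, fun _ _ => rfl⟩
    funext x
    simp [hfk x, hk2 h2.symm]
  · suffices hex : ∃ g ∈ c.explicitFun p, (∀ x, g K x = bary K (c.vertex K 0) x *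
        bary K (c.vertex K 1) x * bary K (c.vertex K 2) x * k x) ∧ ∀ K', K' ≠ K → g K' = 0 by
      obtain ⟨g, hg, h1, h2⟩ := hex
      exact ⟨g, hg, funext fun x => by rw [h1, hfk], h2⟩
    have hspan := mem_span_legendre t.affineCoords_legendre (hk3 h3)
    clear hk2 hk3 hfk
    induction hspan using Submodule.span_induction with
    | mem k hk =>
      obtain ⟨i, j, hij, rfl⟩ := hk
      refine ⟨_, c.modalElementOn_mem hK (r₁ := i) (r₂ := j) (by omega), fun x => ?_,
        fun K' hK' => ?_⟩
      · rw [modalElementOn, if_pos rfl, mul_assoc _ (Polynomial.eval _ _)]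
        simp
      · funext x
        rw [modalElementOn, if_neg hK']
        rfl
    | zero => exact ⟨0, Submodule.zero_mem _, by simp, by simp⟩
    | add k k' _ _ hk hk' =>
      obtain ⟨g, hg, h1, h2⟩ := hk
      obtain ⟨g', hg', h1', h2'⟩ := hk'
      refine ⟨g + g', Submodule.add_mem _ hg hg', fun x => ?_, fun K' hK' => ?_⟩
      · rw [Pi.add_apply, Pi.add_apply, h1, h1', Pi.add_apply]
        ring
      · rw [Pi.add_apply, h2 K' hK', h2' K' hK', add_zero]
    | smul a k _ hk =>
      obtain ⟨g, hg, h1, h2⟩ := hk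
      refine ⟨a • g, Submodule.smul_mem _ _ hg, fun x => ?_, fun K' hK' => ?_⟩
      · rw [Pi.smul_apply, Pi.smul_apply, h1, Pi.smul_apply]
        simp only [smul_eq_mul]
        ring
      · rw [Pi.smul_apply, h2 K' hK', smul_zero]

/-- The elements can be treated separately, since the correction for one element is zero on all
others. -/
theorem Choices.exists_eq_on_elements (c : T.Choices) {p : ℕ} (hp : 2 ≤ p)
    {f : Finset Plane → Plane → ℝ} (hf : f ∈ c.jumpSpace p)
    (hf0 : ∀ F ∈ T.edges, ∀ K ∈ T.patch F, ∀ s,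
      f K (edgePoint (c.endpoint F 0) (c.endpoint F 1) s) = 0) :
    ∃ g ∈ c.explicitFun p, ∀ K ∈ T.elements, f K = g K := by
  have hline : ∀ K ∈ T.elements, ∀ a ∈ K, ∀ b ∈ K, a ≠ b → ∀ t : ℝ,
      f K (AffineMap.lineMap a b t) = 0 := by
    intro K hK a ha b hb hab t
    obtain ⟨F, hF, hKF, hmem⟩ := pair_mem_edges hK ha hb hab
    have ha' := (c.mem_edge_iff hF a).1 ((hmem a).2 (Or.inl rfl))
    have hb' := (c.mem_edge_iff hF b).1 ((hmem b).2 (Or.inr rfl))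
    rcases ha' with rfl | rfl <;> rcases hb' with rfl | rfl
    · exact absurd rfl hab
    · have := hf0 F hF K hKF (2 * t - 1)
      rwa [edgePoint, show (2 * t - 1 + 1) / 2 = t by ring] at this
    -- Here the mesh orients the edge from `b` to `a`, so the parameter is reversed.
    · have := hf0 F hF K hKF (1 - 2 * t)
      rwa [edgePoint, show (1 - 2 * t + 1) / 2 = 1 - t by ring,
        AffineMap.lineMap_apply_one_sub] at this
    · exact absurd rfl hab
  have hex : ∀ K ∈ T.elements, ∃ g ∈ c.explicitFun p, g K = f K ∧ ∀ K', K' ≠ K → g K' = 0 := by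
    intro K hK
    have t := c.isTri hK
    exact c.exists_eq_on_element hp hK (hf.1 K hK)
      (hline K hK _ t.mem_a _ t.mem_b t.ne_ab) (hline K hK _ t.mem_b _ t.mem_c t.ne_bc)
      (hline K hK _ t.mem_c _ t.mem_a t.ne_ac.symm)
  choose! g hg h1 h2 using hex
  refine ⟨∑ K ∈ T.elements, g K, Submodule.sum_mem _ hg, fun K hK => ?_⟩
  rw [Finset.sum_apply, Finset.sum_eq_single_of_mem K hK fun K' hK' hne => h2 K' hK' K hne.symm,
    h1 K hK]

theorem Choices.exists_explicitFun_eq (c : T.Choices) {p : ℕ} (hp : Even p) (hp0 : 0 < p)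
    {f : Finset Plane → Plane → ℝ} (hf : f ∈ c.jumpSpace p) :
    ∃ g ∈ c.explicitFun p, ∀ K ∈ T.elements, f K = g K := by
  have hp2 : 2 ≤ p := by
    obtain ⟨m, rfl⟩ := hp
    omega
  have hodd : Odd (p - 1) := Nat.Even.sub_odd (by omega) hp odd_one
  obtain ⟨g₁, hg₁, h₁⟩ := c.exists_eq_at_vertices hodd hf
  -- The corrections lie in `jumpSpace`, so each remainder stays there and the next stage applies to
  -- it.
  have hf₁ := Submodule.sub_mem _ hf (c.explicitFun_le_jumpSpace p hg₁)
  obtain ⟨g₂, hg₂, h₂⟩ := c.exists_eq_on_edges hp2 hf₁ fun K hK x hx => by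
    rw [Pi.sub_apply, Pi.sub_apply, h₁ K hK x hx, sub_self]
  have hf₂ := Submodule.sub_mem _ hf₁ (c.explicitFun_le_jumpSpace p hg₂)
  obtain ⟨g₃, hg₃, h₃⟩ := c.exists_eq_on_elements hp2 hf₂ fun F hF K hK s => by
    rw [Pi.sub_apply, Pi.sub_apply, h₂ F hF K hK s, sub_self]
  refine ⟨g₁ + g₂ + g₃, Submodule.add_mem _ (Submodule.add_mem _ hg₁ hg₂) hg₃, fun K hK => ?_⟩
  rw [Pi.add_apply, ← h₃ K hK]
  simp only [Pi.add_apply, Pi.sub_apply]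
  abel

end Mesh

end CrouzeixRaviart

end

/-! ### Equality of the implicit and explicit spaces -/

theorem lemma2p2 {Ω : Set CrouzeixRaviart.Plane} (hΩ : interior (closure Ω) = Ω)
    (T : CrouzeixRaviart.Mesh Ω) (c : T.Choices) (p : ℕ) (hp : Even p) (hp0 : 0 < p) :
    c.implicitSpace p = (c.explicitSpace p : Set (MeasureTheory.Lp ℝ 2
      (MeasureTheory.volume.restrict Ω))) := by
  ext v
  rw [c.mem_implicitSpace_iff hp0, SetLike.mem_coe]
  constructor
  · rintro ⟨f, hf, hvf⟩
    obtain ⟨g, hg, hfg⟩ := c.exists_explicitFun_eq hp hp0 hf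
    obtain ⟨w, hw, hwg⟩ := c.exists_explicitSpace hΩ hg
    have hvg : T.Represents v g := fun K hK => hfg K hK ▸ hvf K hK
    rwa [hvg.eq hwg]
  · intro hv
    obtain ⟨f, hf, hvf⟩ := c.exists_explicitFun hΩ hv
    exact ⟨f, c.explicitFun_le_jumpSpace p hf, hvf⟩
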